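/- Consider the 3d Toric Code on the cubic lattice $\mathbb{Z}^3$: a qubit $\mathbb{C}^2$ sits on every edge, $\mathfrak{A}_\Lambda=\mathcal{B}(\bigotimes_{e\in\Lambda}\mathbb{C}^2)$ for finite sets $\Lambda$ of edges, and the quasi-local algebra $\mathfrak{A}$ is the norm closure of $\mathfrak{A}_{loc}=\bigcup_\Lambda\mathfrak{A}_\Lambda$. For a vertex $v$ let $A_v=\prod_{e\ni v}\sigma^x_e$ (six edges), for a face $f$ let $B_f=\prod_{e\in f}\sigma^z_e$ (four edges), and $$H_\Lambda=\sum_{v\in\Lambda}(1-A_v)+\sum_{f\in\Lambda}(1-B_f),$$ the sums running over those $v$ and $f$ all of whose edges lie in $\Lambda$. Let $\delta$ be the closure of the derivation $O\mapsto\lim_{\Lambda}i[H_\Lambda,O]$ on $\mathfrak{A}_{loc}$. A state of $\mathfrak{A}$ is a normalised positive linear functional $\omega$. It is pure if it is an extreme point of the set of states; a ground state if $-i\,\omega(O^*\delta(O))\ge 0$ for all $O$ in the domain of $\delta$; frustration-free if it minimises the expectation of every single term $1-A_v$ and $1-B_f$ among all states; and translation-invariant if it is invariant under the automorphisms of $\mathfrak{A}$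 induced by all lattice translations of $\mathbb{Z}^3$. **Theorem.** There is exactly one state $\omega$ of $\mathfrak{A}$ with $\omega(A_v)=\omega(B_f)=1$ for all vertices $v$ and all faces $f$. This $\omega$ is a pure, frustration-free, translation-invariant ground state, and every frustration-free ground state of the 3d Toric Code is equal to $\omega$. In particular, $\omega$ is the unique pure frustration-free translation-invariant ground state. -/

import Mathlib

open scoped ComplexOrder Topology

noncomputable section

namespace ToricCode3D

/-! ### The lattice `ℤ³` -/

/-- Vertices of the cubic lattice. -/
abbrev Vertex := Fin 3 → ℤ

/-- The edge `(v, i)` joins `v` to `v + eᵢ`; this is its positive orientation. -/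
abbrev Edge := (Fin 3 → ℤ) × Fin 3

/-- The face `(v, i)` is the unit square with corner `v`, spanned by the two unit vectors
`eᵢ₊₁` and `eᵢ₊₂` (indices modulo `3`); its normal direction is `i`. -/
abbrev Face := (Fin 3 → ℤ) × Fin 3

/-- The unit vector `eᵢ`. -/
def unitVec (i : Fin 3) : Vertex := Pi.single i 1

/-- The six edges that contain the vertex `v`. -/
def vertexEdges (v : Vertex) : List Edge :=
  [(v, 0), (v, 1), (v, 2), (v - unitVec 0, 0), (v - unitVec 1, 1), (v - unitVec 2, 2)]

/-- The four edges in the boundary of the face `f`. -/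
def faceEdges (f : Face) : List Edge :=
  [(f.1, f.2 + 1), (f.1, f.2 + 2),
    (f.1 + unitVec (f.2 + 1), f.2 + 2), (f.1 + unitVec (f.2 + 2), f.2 + 1)]

/-! ### The quasi-local algebra

`𝓗_Λ = ⊗_{e ∈ Λ} ℂ²` has the orthonormal basis `Λ → Fin 2`, and `𝓑(𝓗_Λ)` is the algebra of
matrices indexed by this basis.  All the local algebras act faithfully, and compatibly with the
inclusions `M ↦ M ⊗ 1`, on the Hilbert space `ℓ²` of all configurations `Edge → Fin 2`.  The
quasi-local algebra is the norm closure of the union of the local algebras. -/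

/-- Configurations of classical spins on all the edges. -/
abbrev Conf := Edge → Fin 2

/-- The Hilbert space on which the local algebras are represented. -/
abbrev BigHilbert := lp (fun _ : Conf => ℂ) 2

/-- The configuration equal to `t` on `Λ` and to `s` off `Λ`. -/
def splice (Λ : Finset Edge) (s : Conf) (t : Λ → Fin 2) : Conf :=
  fun e => if h : e ∈ Λ then t ⟨e, h⟩ else s e

/-- The restriction of a configuration to `Λ`. -/
def restr (Λ : Finset Edge) (s : Conf) : Λ → Fin 2 := fun e => s e

theorem restr_splice (Λ : Finset Edge) (s : Conf) (t : Λ → Fin 2) :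
    restr Λ (splice Λ s t) = t := by
  funext e
  simp [restr, splice]

theorem splice_restr (Λ : Finset Edge) (s : Conf) : splice Λ s (restr Λ s) = s := by
  funext e
  simp [restr, splice]

theorem splice_splice (Λ : Finset Edge) (s : Conf) (t u : Λ → Fin 2) :
    splice Λ (splice Λ s t) u = splice Λ s u := by
  funext e
  by_cases h : e ∈ Λ <;> simp [splice, h]

theorem memℓp_mul_comp {c : Conf → ℂ} {C : ℝ} (hc : ∀ s, ‖c s‖ ≤ C) {g : Conf → Conf}
    (hg : Function.Injective g) (ψ : BigHilbert) :
    Memℓp (fun s => c s * ψ (g s) : Conf → ℂ) 2 := by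
  have h2 : (0 : ℝ) < (2 : ENNReal).toReal := by norm_num
  have hψ := (memℓp_gen_iff h2).1 (lp.memℓp ψ)
  refine memℓp_gen (Summable.of_nonneg_of_le (fun s => by positivity) (fun s => ?_)
    ((hψ.comp_injective hg).mul_left (C ^ (2 : ENNReal).toReal)))
  rw [norm_mul, Real.mul_rpow (norm_nonneg _) (norm_nonneg _)]
  exact mul_le_mul_of_nonneg_right
    (Real.rpow_le_rpow (norm_nonneg _) (hc s) h2.le) (by positivity)

theorem sum_splice_eq (Λ : Finset Edge) (M : Matrix (Λ → Fin 2) (Λ → Fin 2) ℂ)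
    (ψ : Conf → ℂ) (s : Conf) :
    ∑ t, M (restr Λ s) t * ψ (splice Λ s t) =
      ∑ u : Λ → Fin 2, M (restr Λ s) (restr Λ s + u) * ψ (s + splice Λ 0 u) := by
  refine (Fintype.sum_equiv (Equiv.addLeft (restr Λ s)) _ _ fun u => ?_).symm
  simp only [Equiv.coe_addLeft]
  congr 2
  funext e
  by_cases h : e ∈ Λ <;> simp [splice, restr, h]

theorem memℓp_local (Λ : Finset Edge) (M : Matrix (Λ → Fin 2) (Λ → Fin 2) ℂ) (ψ : BigHilbert) :
    Memℓp (fun s => ∑ t, M (restr Λ s) t * ψ (splice Λ s t) : Conf → ℂ) 2 := by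
  simp_rw [sum_splice_eq Λ M ψ]
  refine Memℓp.finsetSum _ fun u _ => ?_
  refine memℓp_mul_comp (C := ∑ r, ‖M r (r + u)‖) (fun s => ?_)
    (add_left_injective (splice Λ 0 u)) ψ
  exact Finset.single_le_sum (f := fun r => ‖M r (r + u)‖) (fun _ _ => norm_nonneg _)
    (Finset.mem_univ (restr Λ s))

theorem continuous_of_coord (T : BigHilbert →ₗ[ℂ] BigHilbert)
    (hT : ∀ s : Conf, Continuous fun ψ => T ψ s) : Continuous T := by
  have hcoord : ∀ s : Conf, Continuous fun ψ : BigHilbert => ψ s := fun s =>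
    (lp.evalCLM ℂ (fun _ : Conf => ℂ) 2 s).continuous
  refine T.continuous_of_seq_closed_graph fun u x y hu hy => ?_
  ext s
  exact tendsto_nhds_unique (((hcoord s).tendsto y).comp hy) (((hT s).tendsto x).comp hu)

/-- The operator `M ⊗ 1` for `M ∈ 𝓑(𝓗_Λ)`, as a linear map. -/
def localLin (Λ : Finset Edge) (M : Matrix (Λ → Fin 2) (Λ → Fin 2) ℂ) :
    BigHilbert →ₗ[ℂ] BigHilbert where
  toFun ψ := ⟨fun s => ∑ t, M (restr Λ s) t * ψ (splice Λ s t), memℓp_local Λ M ψ⟩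
  map_add' ψ φ := by
    ext s
    change ∑ t, M (restr Λ s) t * (ψ (splice Λ s t) + φ (splice Λ s t)) =
      ∑ t, M (restr Λ s) t * ψ (splice Λ s t) + ∑ t, M (restr Λ s) t * φ (splice Λ s t)
    simp [mul_add, Finset.sum_add_distrib]
  map_smul' c ψ := by
    ext s
    change ∑ t, M (restr Λ s) t * (c * ψ (splice Λ s t)) =
      c * ∑ t, M (restr Λ s) t * ψ (splice Λ s t)
    simp [Finset.mul_sum, mul_left_comm]

/-- The operator `M ⊗ 1` for `M ∈ 𝓑(𝓗_Λ)`, as a bounded operator. -/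
def localOp (Λ : Finset Edge) (M : Matrix (Λ → Fin 2) (Λ → Fin 2) ℂ) :
    BigHilbert →L[ℂ] BigHilbert where
  toLinearMap := localLin Λ M
  cont := continuous_of_coord (localLin Λ M) fun s =>
    continuous_finsetSum _ fun t _ => continuous_const.mul
      (lp.evalCLM ℂ (fun _ : Conf => ℂ) 2 (splice Λ s t)).continuous

theorem localOp_apply (Λ : Finset Edge) (M : Matrix (Λ → Fin 2) (Λ → Fin 2) ℂ)
    (ψ : BigHilbert) (s : Conf) :
    localOp Λ M ψ s = ∑ t, M (restr Λ s) t * ψ (splice Λ s t) := rfl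

open Classical in
theorem localOp_single (Λ : Finset Edge) (M : Matrix (Λ → Fin 2) (Λ → Fin 2) ℂ) (s : Conf) :
    localOp Λ M (lp.single 2 s 1) =
      ∑ t, M t (restr Λ s) • (lp.single 2 (splice Λ s t) 1 : BigHilbert) := by
  ext a
  rw [localOp_apply, lp.coeFn_sum, Finset.sum_apply]
  simp only [lp.coeFn_smul, Pi.smul_apply, smul_eq_mul, lp.coeFn_single, Pi.single_apply]
  rw [Finset.sum_eq_single (restr Λ s), Finset.sum_eq_single (restr Λ a)]
  · congr 1
    refine if_congr ⟨fun h => ?_, fun h => ?_⟩ rfl rfl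
    · rw [← h, splice_splice, splice_restr]
    · conv_lhs => rw [h]
      rw [splice_splice, splice_restr]
  · intro t _ ht
    rw [if_neg, mul_zero]
    rintro rfl
    exact ht (restr_splice _ _ _).symm
  · simp
  · intro t _ ht
    rw [if_neg, mul_zero]
    rintro rfl
    exact ht (restr_splice _ _ _).symm
  · simp

/-- The embedding `M ↦ M ⊗ 1` of `𝓑(𝓗_Λ)`. -/
def localHom (Λ : Finset Edge) :
    Matrix (Λ → Fin 2) (Λ → Fin 2) ℂ →⋆ₐ[ℂ] (BigHilbert →L[ℂ] BigHilbert) where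
  toFun := localOp Λ
  map_one' := by
    ext ψ s
    simp [localOp_apply, Matrix.one_apply, splice_restr]
  map_mul' M N := by
    ext ψ s
    simp only [ContinuousLinearMap.mul_def, ContinuousLinearMap.comp_apply, localOp_apply, restr_splice, splice_splice,
      Matrix.mul_apply, Finset.sum_mul, Finset.mul_sum, mul_assoc]
    exact Finset.sum_comm
  map_zero' := by
    ext ψ s
    simp [localOp_apply]
  map_add' M N := by
    ext ψ s
    simp [localOp_apply, add_mul, Finset.sum_add_distrib]
  commutes' c := by
    ext ψ s
    simp [localOp_apply, Matrix.algebraMap_matrix_apply, splice_restr]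
  map_star' M := by
    classical
    rw [ContinuousLinearMap.star_eq_adjoint]
    ext ψ s
    have h := lp.inner_single_left (𝕜 := ℂ) s (1 : ℂ)
      ((ContinuousLinearMap.adjoint (localOp Λ M)) ψ)
    rw [ContinuousLinearMap.adjoint_inner_right, localOp_single, sum_inner] at h
    simp only [inner_smul_left, lp.inner_single_left] at h
    simp only [RCLike.inner_apply, map_one, mul_one] at h
    rw [← h, localOp_apply]
    simp [Matrix.star_apply]

theorem localHom_apply (Λ : Finset Edge) (M : Matrix (Λ → Fin 2) (Λ → Fin 2) ℂ)
    (ψ : BigHilbert) (s : Conf) :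
    localHom Λ M ψ s = ∑ t, M (restr Λ s) t * ψ (splice Λ s t) := rfl

/-- The embeddings are faithful. -/
theorem localHom_injective (Λ : Finset Edge) : Function.Injective (localHom Λ) := by
  classical
  intro M N h
  ext r t
  have h1 := congrArg (fun T : BigHilbert →L[ℂ] BigHilbert =>
    T (lp.single 2 (splice Λ 0 t) 1) (splice Λ 0 r)) h
  simp only [localHom_apply, restr_splice, splice_splice, lp.coeFn_single,
    Pi.single_apply] at h1
  have hinj : ∀ u, splice Λ 0 u = splice Λ 0 t ↔ u = t := fun u =>
    ⟨fun h => by rw [← restr_splice Λ 0 u, h, restr_splice], fun h => by rw [h]⟩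
  simpa [hinj] using h1

/-- The matrix of `M ⊗ 1` on `𝓗_Λ'`, where `M ∈ 𝓑(𝓗_Λ)` and `Λ ⊆ Λ'`. -/
def ampliation {Λ Λ' : Finset Edge} (h : Λ ⊆ Λ') (M : Matrix (Λ → Fin 2) (Λ → Fin 2) ℂ) :
    Matrix (Λ' → Fin 2) (Λ' → Fin 2) ℂ :=
  Matrix.of fun r t => if ∀ e : Λ', e.1 ∉ Λ → r e = t e then
    M (fun e => r ⟨e.1, h e.2⟩) (fun e => t ⟨e.1, h e.2⟩) else 0

/-- The embeddings are compatible with the inclusions `M ↦ M ⊗ 1`. -/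
theorem localHom_ampliation {Λ Λ' : Finset Edge} (h : Λ ⊆ Λ')
    (M : Matrix (Λ → Fin 2) (Λ → Fin 2) ℂ) : localHom Λ' (ampliation h M) = localHom Λ M := by
  classical
  ext ψ s
  simp only [localHom_apply, ampliation, Matrix.of_apply, ite_mul, zero_mul]
  rw [← Finset.sum_filter]
  refine Finset.sum_bij' (fun t _ => fun e => t ⟨e.1, h e.2⟩)
    (fun u _ => restr Λ' (splice Λ s u)) ?_ ?_ ?_ ?_ ?_
  · simp
  · intro u _
    simp only [Finset.mem_filter, Finset.mem_univ, true_and]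
    intro e he
    simp [restr, splice, he]
  · intro t ht
    simp only [Finset.mem_filter, Finset.mem_univ, true_and] at ht
    funext e
    by_cases he : e.1 ∈ Λ
    · simp [restr, splice, he]
    · simpa [restr, splice, he] using ht e he
  · intro u _
    funext e
    simp [restr, splice]
  · intro t ht
    simp only [Finset.mem_filter, Finset.mem_univ, true_and] at ht
    congr 1
    refine congrArg (fun c : Conf => ψ c) (funext fun e => ?_)
    by_cases he : e ∈ Λ
    · simp [splice, he, h he]
    · by_cases he' : e ∈ Λ'
      · simpa [splice, he, he', restr] using (ht ⟨e, he'⟩ he).symm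
      · simp [splice, he, he']

/-- The algebra `𝔄_Λ` of observables of the region `Λ`. -/
def regionAlgebra (Λ : Finset Edge) : StarSubalgebra ℂ (BigHilbert →L[ℂ] BigHilbert) :=
  (localHom Λ).range

theorem regionAlgebra_mono : Monotone regionAlgebra := by
  rintro Λ Λ' h _ ⟨M, rfl⟩
  exact ⟨ampliation h M, localHom_ampliation h M⟩

/-- The algebra `𝔄_loc` of local observables. -/
def localAlgebra : StarSubalgebra ℂ (BigHilbert →L[ℂ] BigHilbert) := ⨆ Λ, regionAlgebra Λ

/-- `𝔄_loc` is the union of the algebras `𝔄_Λ`. -/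
theorem mem_localAlgebra {a : BigHilbert →L[ℂ] BigHilbert} :
    a ∈ localAlgebra ↔ ∃ Λ M, localHom Λ M = a := by
  have h : (localAlgebra : Set (BigHilbert →L[ℂ] BigHilbert)) =
      ⋃ Λ, (regionAlgebra Λ : Set (BigHilbert →L[ℂ] BigHilbert)) :=
    StarSubalgebra.coe_iSup_of_directed regionAlgebra_mono.directed_le
  rw [← SetLike.mem_coe, h, Set.mem_iUnion]
  rfl

/-- The quasi-local algebra `𝔄`, the norm closure of `𝔄_loc`. -/
abbrev QuasiLocal := ↥(localAlgebra.topologicalClosure)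

instance : IsClosed (localAlgebra.topologicalClosure : Set (BigHilbert →L[ℂ] BigHilbert)) :=
  localAlgebra.isClosed_topologicalClosure

/-- An observable of a finite region as an element of `𝔄`. -/
def ofLocal (Λ : Finset Edge) (M : Matrix (Λ → Fin 2) (Λ → Fin 2) ℂ) : QuasiLocal :=
  ⟨localHom Λ M, localAlgebra.le_topologicalClosure (mem_localAlgebra.2 ⟨Λ, M, rfl⟩)⟩

/-! ### The model -/

/-- The `2 × 2` matrix `m` acting on the qubit at the edge `e`. -/
def onEdge (m : Matrix (Fin 2) (Fin 2) ℂ) (e : Edge) : QuasiLocal :=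
  ofLocal {e} (Matrix.of fun r t => m (r ⟨e, by simp⟩) (t ⟨e, by simp⟩))

def sigmaX : Edge → QuasiLocal := onEdge !![0, 1; 1, 0]

def sigmaZ : Edge → QuasiLocal := onEdge !![1, 0; 0, -1]

/-- The star operator `A_v`, the product of `σˣ` over the six edges that contain `v`. -/
def starOp (v : Vertex) : QuasiLocal := ((vertexEdges v).map sigmaX).prod

/-- The plaquette operator `B_f`, the product of `σᶻ` over the four edges of `f`. -/
def plaqOp (f : Face) : QuasiLocal := ((faceEdges f).map sigmaZ).prod

/-- The vertices `v` of the region `Λ`: all the edges at `v` belong to `Λ`. -/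
def regionVertices (Λ : Finset Edge) : Finset Vertex :=
  (Λ.image Prod.fst).filter fun v => ∀ e ∈ vertexEdges v, e ∈ Λ

/-- The faces `f` of the region `Λ`: all the edges of `f` belong to `Λ`. -/
def regionFaces (Λ : Finset Edge) : Finset Face :=
  (Λ.image Prod.fst ×ˢ Finset.univ).filter fun f => ∀ e ∈ faceEdges f, e ∈ Λ

theorem mem_regionVertices {Λ : Finset Edge} {v : Vertex} :
    v ∈ regionVertices Λ ↔ ∀ e ∈ vertexEdges v, e ∈ Λ := by
  simp only [regionVertices, Finset.mem_filter, and_iff_right_iff_imp]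
  intro h
  exact Finset.mem_image.2 ⟨(v, 0), h _ (by simp [vertexEdges]), rfl⟩

theorem mem_regionFaces {Λ : Finset Edge} {f : Face} :
    f ∈ regionFaces Λ ↔ ∀ e ∈ faceEdges f, e ∈ Λ := by
  simp only [regionFaces, Finset.mem_filter, and_iff_right_iff_imp, Finset.mem_product,
    Finset.mem_univ, and_true]
  intro h
  exact Finset.mem_image.2 ⟨(f.1, f.2 + 1), h _ (by simp [faceEdges]), rfl⟩

/-- The Hamiltonian `H_Λ` of a finite region. -/
def hamiltonian (Λ : Finset Edge) : QuasiLocal :=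
  ∑ v ∈ regionVertices Λ, (1 - starOp v) + ∑ f ∈ regionFaces Λ, (1 - plaqOp f)

/-- The graph of the derivation `δ(O) = lim_Λ i[H_Λ, O]` with domain `𝔄_loc`. -/
def localDerivationGraph : Set (QuasiLocal × QuasiLocal) :=
  {p | (p.1 : BigHilbert →L[ℂ] BigHilbert) ∈ localAlgebra ∧
    Filter.Tendsto (fun Λ : Finset Edge =>
      Complex.I • (hamiltonian Λ * p.1 - p.1 * hamiltonian Λ)) Filter.atTop (𝓝 p.2)}

/-- The graph of the closure of `δ`, the generator of the dynamics. -/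
def derivationGraph : Set (QuasiLocal × QuasiLocal) := closure localDerivationGraph

/-! ### States -/

/-- The states of `𝔄`: the normalised positive linear functionals. -/
def states : Set (QuasiLocal →ₗ[ℂ] ℂ) :=
  {ω | (∀ a : QuasiLocal, 0 ≤ ω (star a * a)) ∧ ω 1 = 1}

/-- A pure state is an extreme point of the set of states. -/
def IsPureState (ω : QuasiLocal →ₗ[ℂ] ℂ) : Prop := ω ∈ states.extremePoints ℝ

/-- A ground state: `-i ω(O* δ(O)) ≥ 0` for all `O` in the domain of `δ`. -/
def IsGroundState (ω : QuasiLocal →ₗ[ℂ] ℂ) : Prop :=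
  ω ∈ states ∧ ∀ O D : QuasiLocal, (O, D) ∈ derivationGraph → 0 ≤ -Complex.I * ω (star O * D)

/-- A frustration-free state minimises each term of the Hamiltonian among all states. -/
def IsFrustrationFree (ω : QuasiLocal →ₗ[ℂ] ℂ) : Prop :=
  ω ∈ states ∧ (∀ v, ∀ φ ∈ states, ω (1 - starOp v) ≤ φ (1 - starOp v)) ∧
    ∀ f, ∀ φ ∈ states, ω (1 - plaqOp f) ≤ φ (1 - plaqOp f)

/-! ### Translations -/

/-- Translation of edges by a lattice vector. -/
def shiftEdge (x : Vertex) : Edge ≃ Edge := (Equiv.addRight x).prodCongr (Equiv.refl _)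

/-- Translation of configurations by `x`. -/
def shiftConf (x : Vertex) : Conf ≃ Conf := (shiftEdge x).arrowCongr (Equiv.refl _)

/-- The unitary that permutes the basis configurations by translation by `x`. -/
def shiftUnitary (x : Vertex) : BigHilbert ≃ₗᵢ[ℂ] BigHilbert where
  toFun ψ := ⟨fun s => ψ ((shiftConf x).symm s), by
    have h := memℓp_mul_comp (c := 1) (C := 1) (by simp) (shiftConf x).symm.injective ψ
    simp only [Pi.one_apply, one_mul] at h
    exact h⟩
  invFun ψ := ⟨fun s => ψ (shiftConf x s), by
    have h := memℓp_mul_comp (c := 1) (C := 1) (by simp) (shiftConf x).injective ψ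
    simp only [Pi.one_apply, one_mul] at h
    exact h⟩
  map_add' ψ φ := rfl
  map_smul' c ψ := rfl
  left_inv ψ := by
    ext s
    simp
  right_inv ψ := by
    ext s
    simp
  norm_map' ψ := by
    have h2 : (0 : ℝ) < (2 : ENNReal).toReal := by norm_num
    rw [lp.norm_eq_tsum_rpow h2, lp.norm_eq_tsum_rpow h2]
    congr 1
    exact (shiftConf x).symm.tsum_eq fun s => ‖ψ s‖ ^ (2 : ENNReal).toReal

/-- `M ∈ 𝓑(𝓗_Λ)` moved to the region `Λ + x`. -/
def shiftMatrix (x : Vertex) (Λ : Finset Edge) (M : Matrix (Λ → Fin 2) (Λ → Fin 2) ℂ) :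
    Matrix (↥(Λ.map (shiftEdge x).toEmbedding) → Fin 2)
      (↥(Λ.map (shiftEdge x).toEmbedding) → Fin 2) ℂ :=
  Matrix.of fun r t => M (fun e : Λ => r ⟨shiftEdge x e.1, Finset.mem_map_of_mem (shiftEdge x).toEmbedding e.2⟩)
    (fun e : Λ => t ⟨shiftEdge x e.1, Finset.mem_map_of_mem (shiftEdge x).toEmbedding e.2⟩)

theorem conj_localHom (x : Vertex) (Λ : Finset Edge) (M : Matrix (Λ → Fin 2) (Λ → Fin 2) ℂ) :
    (shiftUnitary x).conjStarAlgEquiv (localHom Λ M) = localHom _ (shiftMatrix x Λ M) := by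
  ext ψ s
  change ∑ t, M (restr Λ ((shiftConf x).symm s)) t *
      ψ (shiftConf x (splice Λ ((shiftConf x).symm s) t)) = _
  rw [localHom_apply]
  have hmem : ∀ e : Edge, (shiftEdge x).symm e ∈ Λ ↔ e ∈ Λ.map (shiftEdge x).toEmbedding :=
    fun e => by simp
  refine Fintype.sum_bijective
    (fun t => fun e => t ⟨(shiftEdge x).symm e.1, (hmem _).2 e.2⟩)
    (Function.bijective_iff_has_inverse.2
      ⟨fun u => fun e : Λ => u ⟨shiftEdge x e.1, Finset.mem_map_of_mem (shiftEdge x).toEmbedding e.2⟩, ?_, ?_⟩) _ _ ?_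
  · intro t
    funext e
    simp
  · intro u
    funext e
    simp
  · intro t
    simp only [shiftMatrix, Matrix.of_apply, Equiv.symm_apply_apply]
    congr 1
    refine congrArg (fun c : Conf => ψ c) (funext fun e => ?_)
    simp only [shiftConf, Equiv.arrowCongr_apply, Equiv.arrowCongr_symm, Function.comp_apply,
      Equiv.refl_apply, Equiv.refl_symm, splice, hmem, Equiv.symm_symm, Equiv.apply_symm_apply]

theorem conj_mem (x : Vertex) (a : QuasiLocal) :
    (shiftUnitary x).conjStarAlgEquiv (a : BigHilbert →L[ℂ] BigHilbert) ∈
      localAlgebra.topologicalClosure := by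
  have hc : Continuous fun T : BigHilbert →L[ℂ] BigHilbert =>
      (shiftUnitary x).conjStarAlgEquiv T :=
    (StarAlgEquiv.isometry (shiftUnitary x).conjStarAlgEquiv).continuous
  refine map_mem_closure hc a.2 fun T hT => ?_
  obtain ⟨Λ, M, rfl⟩ := mem_localAlgebra.1 hT
  exact mem_localAlgebra.2 ⟨_, _, (conj_localHom x Λ M).symm⟩

/-- The translation `τ_x` of observables; `τ_x 𝔄_Λ = 𝔄_{Λ + x}`. -/
def translate (x : Vertex) (a : QuasiLocal) : QuasiLocal :=
  ⟨(shiftUnitary x).conjStarAlgEquiv (a : BigHilbert →L[ℂ] BigHilbert), conj_mem x a⟩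

theorem translate_ofLocal (x : Vertex) (Λ : Finset Edge)
    (M : Matrix (Λ → Fin 2) (Λ → Fin 2) ℂ) :
    translate x (ofLocal Λ M) = ofLocal _ (shiftMatrix x Λ M) :=
  Subtype.ext (conj_localHom x Λ M)

def IsTranslationInvariant (ω : QuasiLocal →ₗ[ℂ] ℂ) : Prop :=
  ∀ x a, ω (translate x a) = ω a

end ToricCode3D

end

open scoped ComplexOrder Topology

noncomputable section

namespace ToricCode3D

/-! ### Positive functionals on a C*-algebra -/

section PositiveFunctional

variable {A : Type*} [CStarAlgebra A] {ω : A →ₗ[ℂ] ℂ}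

/-! This is the stabilizer argument. If `u` is a self-adjoint unitary and `ω u = 1`, Cauchy–Schwarz
for `ω` shows that `u` can be inserted or removed on either side of an observable without changing
its expectation. With all `A_v` and `B_f` as such `u`, consider a Pauli operator with X-part `a` and
Z-part `b`. If it anticommutes with some stabilizer, its expectation equals its own negative and is
zero. Otherwise `a` is a finite cocycle and `b` a finite cycle modulo 2. On `ℤ³` such an `a` is a
finite sum of vertex coboundaries (`mem_span_coboundary`) and such a `b` a finite sum of face
boundaries (`mem_span_boundary`), so the operator is a product of stabilizers and has expectation 1.
Both facts rest on `exists_eq_differential`. Paulis span the local algebra, which is dense, and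
states are continuous; hence uniqueness (`stabilizedStates_subsingleton`). Existence is a weak-*
limit of vector states fixed by all `B_f` and by finitely many `A_v`. Purity, translation invariance
and equality with every frustration-free state then follow from uniqueness. The ground state
inequality follows because each term is positive and has expectation zero. -/

theorem continuous_of_forall_nonneg (hω : ∀ a, 0 ≤ ω (star a * a)) : Continuous ω := by
  -- In the spectral order the nonnegative elements are exactly the `star b * b`, so `hω` becomes
  -- monotonicity, and positive linear maps are bounded.
  let := CStarAlgebra.spectralOrder A
  let := CStarAlgebra.spectralOrderedRing A
  obtain ⟨C, hC⟩ := (PositiveLinearMap.mk₀ ω fun a ha => by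
    obtain ⟨b, rfl⟩ := CStarAlgebra.nonneg_iff_eq_star_mul_self.1 ha
    exact hω b).exists_norm_apply_le
  exact AddMonoidHomClass.continuous_of_bound ω C hC

/-- Cauchy–Schwarz in the pre-GNS space of `ω`. -/
theorem norm_sq_apply_star_mul_le (hω : ∀ a, 0 ≤ ω (star a * a)) (a b : A) :
    ‖ω (star a * b)‖ ^ 2 ≤ (ω (star a * a)).re * (ω (star b * b)).re := by
  let := CStarAlgebra.spectralOrder A
  let := CStarAlgebra.spectralOrderedRing A
  let φ := PositiveLinearMap.mk₀ ω fun a ha => by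
    obtain ⟨b, rfl⟩ := CStarAlgebra.nonneg_iff_eq_star_mul_self.1 ha
    exact hω b
  have hφ : ∀ x y, inner ℂ (φ.toPreGNS x) (φ.toPreGNS y) = ω (star x * y) := fun x y => rfl
  have h := norm_inner_le_norm (𝕜 := ℂ) (φ.toPreGNS a) (φ.toPreGNS b)
  have ha := inner_self_eq_norm_sq (𝕜 := ℂ) (φ.toPreGNS a)
  have hb := inner_self_eq_norm_sq (𝕜 := ℂ) (φ.toPreGNS b)
  rw [hφ] at h ha hb
  change (ω (star a * a)).re = _ at ha
  change (ω (star b * b)).re = _ at hb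
  rw [ha, hb, ← mul_pow]
  exact pow_le_pow_left₀ (norm_nonneg _) h 2

theorem apply_mul_eq_zero (hω : ∀ a, 0 ≤ ω (star a * a)) {c : A} (hc : ω (star c * c) = 0)
    (a : A) : ω (a * c) = 0 := by
  have h := norm_sq_apply_star_mul_le hω (star a) c
  rw [star_star, hc, Complex.zero_re, mul_zero] at h
  exact norm_eq_zero.1 (pow_eq_zero_iff two_ne_zero |>.1 (le_antisymm h (sq_nonneg _)))

theorem apply_star_mul_eq_zero (hω : ∀ a, 0 ≤ ω (star a * a)) {c : A}
    (hc : ω (star c * c) = 0) (a : A) : ω (star c * a) = 0 := by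
  have h := norm_sq_apply_star_mul_le hω c a
  rw [hc, Complex.zero_re, zero_mul] at h
  exact norm_eq_zero.1 (pow_eq_zero_iff two_ne_zero |>.1 (le_antisymm h (sq_nonneg _)))

/-- Equivalently, `(1 - u) / 2` is a projection. This makes each term of the Hamiltonian positive.
-/
theorem two_smul_one_sub {u : A} (hu : star u = u) (hu2 : u * u = 1) :
    star (1 - u) * (1 - u) = (2 : ℂ) • (1 - u) := by
  rw [star_sub, star_one, hu, two_smul, mul_sub, sub_mul, mul_one, mul_one, sub_mul, one_mul, hu2]
  abel

theorem nonneg_of_two_mul_nonneg {z : ℂ} (hz : 0 ≤ 2 * z) : 0 ≤ z := by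
  simpa [Complex.nonneg_iff, eq_comm] using hz

theorem one_sub_apply_nonneg (hω : ∀ a, 0 ≤ ω (star a * a)) {u : A} (hu : star u = u)
    (hu2 : u * u = 1) : 0 ≤ ω (1 - u) := by
  have h := hω (1 - u)
  rw [two_smul_one_sub hu hu2, map_smul, smul_eq_mul] at h
  exact nonneg_of_two_mul_nonneg h

theorem conj_one_sub_apply_nonneg (hω : ∀ a, 0 ≤ ω (star a * a)) {u : A} (hu : star u = u)
    (hu2 : u * u = 1) (a : A) : 0 ≤ ω (star a * ((1 - u) * a)) := by
  have h := hω ((1 - u) * a)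
  rw [star_mul, mul_assoc, ← mul_assoc (star (1 - u)), two_smul_one_sub hu hu2,
    smul_mul_assoc, mul_smul_comm, map_smul, smul_eq_mul] at h
  exact nonneg_of_two_mul_nonneg h

variable (hω : ∀ a, 0 ≤ ω (star a * a)) (hω1 : ω 1 = 1) {u : A} (hu : star u = u)
  (hu2 : u * u = 1) (huω : ω u = 1)

include hω hω1 hu hu2 huω in
theorem apply_mul_one_sub (a : A) : ω (a * (1 - u)) = 0 :=
  apply_mul_eq_zero hω (by rw [two_smul_one_sub hu hu2]; simp [hω1, huω]) a

include hω hω1 hu hu2 huω in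
theorem apply_mul_stabilizer (a : A) : ω (a * u) = ω a := by
  have h := apply_mul_one_sub hω hω1 hu hu2 huω a
  rw [mul_sub, mul_one, map_sub, sub_eq_zero] at h
  exact h.symm

include hω hω1 hu hu2 huω in
theorem apply_stabilizer_mul (a : A) : ω (u * a) = ω a := by
  have h := apply_star_mul_eq_zero hω (c := 1 - u)
    (by rw [two_smul_one_sub hu hu2]; simp [hω1, huω]) a
  rw [star_sub, star_one, hu, sub_mul, one_mul, map_sub, sub_eq_zero] at h
  exact h.symm

/-! ### The ground state inequality under limits and closures -/

theorem continuous_energy (hω : ∀ a, 0 ≤ ω (star a * a)) :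
    Continuous fun p : A × A => -Complex.I * ω (star p.1 * p.2) :=
  continuous_const.mul ((continuous_of_forall_nonneg hω).comp
    ((continuous_star.comp continuous_fst).mul continuous_snd))

theorem energy_nonneg_of_mem_closure (hω : ∀ a, 0 ≤ ω (star a * a)) {S : Set (A × A)}
    (hS : ∀ p ∈ S, 0 ≤ -Complex.I * ω (star p.1 * p.2)) {p : A × A} (hp : p ∈ closure S) :
    0 ≤ -Complex.I * ω (star p.1 * p.2) :=
  closure_minimal hS (isClosed_Ici.preimage (continuous_energy hω)) hp

/-- When `ω` annihilates the term with `h` on the far right, only the manifestly positive half of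
the commutator survives. -/
theorem energy_commutator {h a : A} (hh : ω (star a * a * h) = 0) :
    -Complex.I * ω (star a * (Complex.I • (h * a - a * h))) = ω (star a * (h * a)) := by
  rw [mul_smul_comm, map_smul, smul_eq_mul, ← mul_assoc, neg_mul, Complex.I_mul_I, neg_neg,
    one_mul, mul_sub, map_sub, ← mul_assoc (star a) a, hh, sub_zero]

theorem energy_nonneg_of_tendsto (hω : ∀ a, 0 ≤ ω (star a * a)) {ι : Type*} {l : Filter ι}
    [l.NeBot] {h : ι → A} (h0 : ∀ i a, ω (a * h i) = 0)
    (hpos : ∀ i a, 0 ≤ ω (star a * (h i * a))) {a d : A}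
    (hd : Filter.Tendsto (fun i => Complex.I • (h i * a - a * h i)) l (𝓝 d)) :
    0 ≤ -Complex.I * ω (star a * d) := by
  have hlim := ((continuous_energy hω).tendsto (a, d)).comp (tendsto_const_nhds.prodMk_nhds hd)
  refine ge_of_tendsto' hlim fun i => ?_
  simp only [Function.comp_apply]
  rw [energy_commutator (h0 i _)]
  exact hpos i a

end PositiveFunctional

/-! ### Cycles and cocycles modulo `2` on the cubic lattice -/

/-- Finite sets of edges, as chains modulo `2`. -/
abbrev Chain := Edge →₀ ZMod 2

/-- The set of edges that contain the vertex `v`. -/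
def coboundary (v : Vertex) : Chain :=
  ((vertexEdges v).map fun e => Finsupp.single e (1 : ZMod 2)).sum

/-- The set of edges of the face `f`. -/
def boundary (f : Face) : Chain :=
  ((faceEdges f).map fun e => Finsupp.single e (1 : ZMod 2)).sum

/-- The pairing of a finite chain with a cochain. -/
def pairing (b : Chain) (s : Edge → ZMod 2) : ZMod 2 := b.sum fun e x => x * s e

theorem pairing_eq_linearCombination (b : Chain) (s : Edge → ZMod 2) :
    pairing b s = Finsupp.linearCombination (ZMod 2) s b := by
  simp [pairing, Finsupp.linearCombination_apply]

theorem pairing_zero_left (s : Edge → ZMod 2) : pairing 0 s = 0 := by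
  simp [pairing]

theorem pairing_add_left (b b' : Chain) (s : Edge → ZMod 2) :
    pairing (b + b') s = pairing b s + pairing b' s := by
  simp [pairing_eq_linearCombination]

theorem pairing_single (e : Edge) (s : Edge → ZMod 2) :
    pairing (Finsupp.single e 1) s = s e := by
  simp [pairing]

theorem pairing_add_right (b : Chain) (s t : Edge → ZMod 2) :
    pairing b (s + t) = pairing b s + pairing b t := by
  simp [pairing, mul_add, Finsupp.sum_add]

theorem pairing_zero_right (b : Chain) : pairing b 0 = 0 := by
  simp [pairing]

theorem pairing_congr {b : Chain} {s t : Edge → ZMod 2} (h : ∀ e ∈ b.support, s e = t e) :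
    pairing b s = pairing b t :=
  Finset.sum_congr rfl fun e he => congrArg (b e * ·) (h e he)

theorem pairing_sum_smul_right {ι : Type*} (W : Finset ι) (b : Chain) (g : ι → ZMod 2)
    (s : ι → Edge → ZMod 2) :
    pairing b (∑ v ∈ W, g v • s v) = ∑ v ∈ W, g v * pairing b (s v) := by
  simp only [pairing, Finsupp.sum, Finset.sum_apply, Pi.smul_apply, smul_eq_mul, Finset.mul_sum]
  rw [Finset.sum_comm]
  exact Finset.sum_congr rfl fun _ _ => Finset.sum_congr rfl fun _ _ => by ring

theorem coboundary_apply (v w : Vertex) (i : Fin 3) :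
    coboundary v (w, i) = (if v = w then 1 else 0) + if v = w + unitVec i then 1 else 0 := by
  have h : ∀ j, v - unitVec j = w ↔ v = w + unitVec j := fun j => sub_eq_iff_eq_add
  fin_cases i <;>
    simp [coboundary, vertexEdges, Finsupp.single_apply, Prod.ext_iff, h]

theorem sum_smul_coboundary_apply (W : Finset Vertex) (g : Vertex → ZMod 2) (w : Vertex)
    (i : Fin 3) : (∑ v ∈ W, g v • coboundary v) (w, i) =
      (if w ∈ W then g w else 0) + if w + unitVec i ∈ W then g (w + unitVec i) else 0 := by
  simp [Finsupp.finsetSum_apply, coboundary_apply, mul_add, Finset.sum_add_distrib]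

theorem pairing_boundary (f : Face) (s : Edge → ZMod 2) :
    pairing (boundary f) s = s (f.1, f.2 + 1) + s (f.1, f.2 + 2) +
      s (f.1 + unitVec (f.2 + 1), f.2 + 2) + s (f.1 + unitVec (f.2 + 2), f.2 + 1) := by
  simp [boundary, faceEdges, pairing_add_left, pairing_single, add_assoc]

/-- Each corner of a face lies on exactly two of its edges. The generalized `a`, `b`, `c`, `d`
indicate which corner `v` is. -/
theorem pairing_boundary_coboundary (f : Face) (v : Vertex) :
    pairing (boundary f) (coboundary v) = 0 := by
  rw [pairing_boundary]
  simp only [coboundary_apply]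
  rw [add_right_comm f.1 (unitVec (f.2 + 2))]
  generalize (if v = f.1 then (1 : ZMod 2) else 0) = a
  generalize (if v = f.1 + unitVec (f.2 + 1) then (1 : ZMod 2) else 0) = b
  generalize (if v = f.1 + unitVec (f.2 + 2) then (1 : ZMod 2) else 0) = c
  generalize (if v = f.1 + unitVec (f.2 + 1) + unitVec (f.2 + 2) then (1 : ZMod 2) else 0) = d
  revert a b c d
  decide

/-! ### Exactness of closed cochains, and finite cycles and cocycles -/

theorem exists_antiderivative_int (h : ℤ → ZMod 2) :
    ∃ I : ℤ → ZMod 2, ∀ n, I (n + 1) = I n + h n := by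
  -- A signed sum from `0` to `n`: at most one of the two intervals is nonempty.
  refine ⟨fun n => ∑ k ∈ Finset.Ico 0 n, h k - ∑ k ∈ Finset.Ico n 0, h k, fun n => ?_⟩
  beta_reduce
  rcases le_or_gt 0 n with hn | hn
  · rw [Finset.Ico_eq_empty (by omega : ¬ n + 1 < 0), Finset.Ico_eq_empty (by omega : ¬ n < 0),
      ← Finset.insert_Ico_right_eq_Ico_add_one hn, Finset.sum_insert (by simp)]
    ring
  · rw [Finset.Ico_eq_empty (by omega : ¬ 0 < n + 1), Finset.Ico_eq_empty (by omega : ¬ 0 < n),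
      ← Finset.insert_Ico_add_one_left_eq_Ico hn, Finset.sum_insert (by simp)]
    ring

/-- Integrate along each line in direction `i`, starting on the hyperplane where coordinate `i` is
zero. The second clause lets a later integration preserve components that have already been made
zero. -/
theorem exists_antiderivative (h : Vertex → ZMod 2) (i : Fin 3) :
    ∃ G : Vertex → ZMod 2, (∀ v, G (v + unitVec i) = G v + h v) ∧
      ∀ j ≠ i, (∀ v, h (v + unitVec j) = h v) → ∀ v, G (v + unitVec j) = G v := by
  choose I hI using exists_antiderivative_int
  refine ⟨fun v => I (fun k => h (Function.update v i k)) (v i), fun v => ?_, fun j hj hh v => ?_⟩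
  · have hu : ∀ k, Function.update (v + unitVec i) i k = Function.update v i k := fun k => by
      ext l
      by_cases hl : l = i
      · subst hl; simp
      · simp [unitVec, hl]
    have hv : (v + unitVec i) i = v i + 1 := by simp [unitVec]
    simp only [hu, hv, hI, Function.update_eq_self]
  · have hu : ∀ k, Function.update (v + unitVec j) i k =
        Function.update v i k + unitVec j := fun k => by
      ext l
      by_cases hl : l = i
      · subst hl; simp [unitVec, hj.symm]
      · simp [Function.update_of_ne hl]
    have hv : (v + unitVec j) i = v i := by simp [unitVec, hj.symm]
    simp only [hu, hv, hh]

theorem eq_of_face_sum_eq_zero {a b c d : ZMod 2} (h : a + b + c + d = 0) (ha : a = 0)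
    (hd : d = 0) : c = b := by
  subst ha hd
  revert b c
  decide

/-- A closed cochain modulo `2` on the cubic lattice is exact. -/
theorem exists_eq_differential (s : Edge → ZMod 2) (hs : ∀ f, pairing (boundary f) s = 0) :
    ∃ g : Vertex → ZMod 2, ∀ v i, s (v, i) = g v + g (v + unitVec i) := by
  let d : (Vertex → ZMod 2) → Edge → ZMod 2 := fun g e => g e.1 + g (e.1 + unitVec e.2)
  have hd : ∀ g f, pairing (boundary f) (d g) = 0 := fun g f => by
    rw [pairing_boundary]
    simp only [d]
    rw [add_right_comm f.1 (unitVec (f.2 + 2))]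
    generalize g _ = a
    generalize g _ = b
    generalize g _ = c
    generalize g _ = d
    revert a b c d
    decide
  have hds : ∀ s g, (∀ f, pairing (boundary f) s = 0) → ∀ f, pairing (boundary f) (s + d g) = 0 :=
    fun s g h f => by rw [pairing_add_right, h, hd, add_zero]
  have h2 : ∀ x y : ZMod 2, x + (y + (y + x)) = 0 := by decide
  have h3 : ∀ x : ZMod 2, 0 + (x + x) = 0 := by decide
  -- The components in directions 0, 1, 2 are removed in turn by adding differentials. Once the
  -- earlier components vanish, closedness on a face says that the next one is constant in the
  -- earlier directions, so its antiderivative is too and does not disturb them.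
  obtain ⟨g₀, hg₀, -⟩ := exists_antiderivative (fun v => s (v, 0)) 0
  have hs₁ := hds s g₀ hs
  set s₁ := s + d g₀
  have h10 : ∀ v, s₁ (v, 0) = 0 := fun v => by
    change s (v, 0) + (g₀ v + g₀ (v + unitVec 0)) = 0
    rw [hg₀]
    exact h2 _ _
  have h11 : ∀ v, s₁ (v + unitVec 0, 1) = s₁ (v, 1) := fun v => by
    have h := hs₁ (v, 2)
    rw [pairing_boundary] at h
    exact eq_of_face_sum_eq_zero h (h10 _) (h10 _)
  obtain ⟨g₁, hg₁, hg₁'⟩ := exists_antiderivative (fun v => s₁ (v, 1)) 1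
  have hs₂ := hds s₁ g₁ hs₁
  set s₂ := s₁ + d g₁
  have h20 : ∀ v, s₂ (v, 0) = 0 := fun v => by
    change s₁ (v, 0) + (g₁ v + g₁ (v + unitVec 0)) = 0
    rw [hg₁' 0 (by decide) h11, h10]
    exact h3 _
  have h21 : ∀ v, s₂ (v, 1) = 0 := fun v => by
    change s₁ (v, 1) + (g₁ v + g₁ (v + unitVec 1)) = 0
    rw [hg₁]
    exact h2 _ _
  have h22 : ∀ v, s₂ (v + unitVec 0, 2) = s₂ (v, 2) := fun v => by
    have h := hs₂ (v, 1)
    rw [pairing_boundary] at h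
    change s₂ (v, 2) + s₂ (v, 0) + s₂ (v + unitVec 2, 0) + s₂ (v + unitVec 0, 2) = 0 at h
    refine eq_of_face_sum_eq_zero (a := s₂ (v, 0)) (d := s₂ (v + unitVec 2, 0)) ?_ (h20 _) (h20 _)
    rw [← h]
    ring
  have h23 : ∀ v, s₂ (v + unitVec 1, 2) = s₂ (v, 2) := fun v => by
    have h := hs₂ (v, 0)
    rw [pairing_boundary] at h
    exact eq_of_face_sum_eq_zero h (h21 _) (h21 _)
  obtain ⟨g₂, hg₂, hg₂'⟩ := exists_antiderivative (fun v => s₂ (v, 2)) 2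
  have h3i : ∀ v i, s₂ (v, i) + (g₂ v + g₂ (v + unitVec i)) = 0 := fun v i => by
    fin_cases i
    · change s₂ (v, 0) + (g₂ v + g₂ (v + unitVec 0)) = 0
      rw [hg₂' 0 (by decide) h22, h20]
      exact h3 _
    · change s₂ (v, 1) + (g₂ v + g₂ (v + unitVec 1)) = 0
      rw [hg₂' 1 (by decide) h23, h21]
      exact h3 _
    · change s₂ (v, 2) + (g₂ v + g₂ (v + unitVec 2)) = 0
      rw [hg₂]
      exact h2 _ _
  refine ⟨g₀ + g₁ + g₂, fun v i => ?_⟩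
  have h : s (v, i) + (g₀ v + g₀ (v + unitVec i)) + (g₁ v + g₁ (v + unitVec i)) +
    (g₂ v + g₂ (v + unitVec i)) = 0 := h3i v i
  simp only [Pi.add_apply]
  rw [← CharTwo.add_eq_zero, ← h]
  ring

/-- A finite cycle modulo `2` is the boundary of a finite set of faces. -/
theorem mem_span_boundary {b : Chain} (hb : ∀ v, pairing b (coboundary v) = 0) :
    b ∈ Submodule.span (ZMod 2) (Set.range boundary) := by
  -- Duality: a functional that kills all boundaries but not `b` is a closed cochain, possibly of
  -- infinite support. It is therefore exact, and this forces its value on the cycle `b` to be zero.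
  by_contra hmem
  obtain ⟨φ, hφb, hφ⟩ := Submodule.exists_le_ker_of_notMem hmem
  have hpair : ∀ c, φ c = pairing c fun e => φ (Finsupp.single e 1) := fun c => by
    rw [pairing_eq_linearCombination]
    refine LinearMap.congr_fun (Finsupp.lhom_ext' fun e => LinearMap.ext_ring ?_) c
    simp
  obtain ⟨g, hg⟩ := exists_eq_differential (fun e => φ (Finsupp.single e 1)) fun f => by
    rw [← hpair]
    exact hφ (Submodule.subset_span ⟨f, rfl⟩)
  refine hφb ?_
  -- All endpoints of edges of `b`: cutting the potential off outside `W` leaves its differential on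
  -- those edges unchanged.
  let W : Finset Vertex := b.support.image Prod.fst ∪
    b.support.image fun e => e.1 + unitVec e.2
  have hW : pairing b (fun e => φ (Finsupp.single e 1)) =
      pairing b (∑ v ∈ W, g v • (coboundary v : Edge → ZMod 2)) := by
    refine pairing_congr fun e he => ?_
    have h := sum_smul_coboundary_apply W g e.1 e.2
    rw [if_pos (Finset.mem_union_left _ (Finset.mem_image_of_mem _ he)),
      if_pos (Finset.mem_union_right _ (Finset.mem_image_of_mem
        (fun e : Edge => e.1 + unitVec e.2) he)), ← hg] at h
    simp only [Finsupp.finsetSum_apply, Finsupp.smul_apply] at h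
    rw [Finset.sum_apply]
    exact h.symm
  rw [hpair, hW, pairing_sum_smul_right]
  exact Finset.sum_eq_zero fun v _ => by rw [hb, mul_zero]

/-- Moving in direction `i` keeps coordinate `j`, so invariance within one hyperplane suffices. It
is used to travel outside a box without crossing it. -/
theorem update_eq_of_forall_shift {g : Vertex → ZMod 2} {i j : Fin 3} (hij : i ≠ j)
    {v : Vertex} (h : ∀ w : Vertex, w j = v j → g (w + unitVec i) = g w) (k : ℤ) :
    g (Function.update v i k) = g v := by
  have hstep : ∀ k, g (Function.update v i (k + 1)) = g (Function.update v i k) := fun k => by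
    rw [← h (Function.update v i k) (Function.update_of_ne hij.symm _ _)]
    congr 1
    ext l
    by_cases hl : l = i
    · subst hl; simp [unitVec]
    · simp [unitVec, hl]
  have hconst : ∀ k, g (Function.update v i k) = g (Function.update v i 0) := fun k => by
    induction k using Int.induction_on with
    | zero => rfl
    | succ n ih => rw [hstep, ih]
    | pred n ih => rw [← ih, ← hstep, sub_add_cancel]
  rw [hconst, ← hconst (v i), Function.update_eq_self]

/-- A finite cocycle modulo `2` is the coboundary of a finite set of vertices. -/
theorem mem_span_coboundary {a : Chain} (ha : ∀ f, pairing (boundary f) a = 0) :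
    a ∈ Submodule.span (ZMod 2) (Set.range coboundary) := by
  obtain ⟨g, hg⟩ := exists_eq_differential a ha
  obtain ⟨N, hN⟩ : ∃ N : ℕ, ∀ e ∈ a.support, ∀ j, (e.1 j).natAbs < N := by
    refine ⟨(a.support.sup fun e => ∑ j, (e.1 j).natAbs) + 1, fun e he j => ?_⟩
    refine Nat.lt_succ_of_le (le_trans ?_ (Finset.le_sup
      (f := fun e : Edge => ∑ j, (e.1 j).natAbs) he))
    exact Finset.single_le_sum (f := fun j => (e.1 j).natAbs) (fun _ _ => Nat.zero_le _)
      (Finset.mem_univ j)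
  have hshift : ∀ (v : Vertex) (j : Fin 3), N ≤ (v j).natAbs →
      ∀ i, ∀ w : Vertex, w j = v j → g (w + unitVec i) = g w := fun v j hv i w hw => by
    have h0 : a (w, i) = 0 := by
      by_contra h
      have := hN _ (Finsupp.mem_support_iff.2 h) j
      simp only [hw] at this
      omega
    rw [hg, CharTwo.add_eq_zero] at h0
    exact h0.symm
  have hupd : ∀ (v : Vertex) (i j : Fin 3), i ≠ j → N ≤ (v j).natAbs →
      g (Function.update v i N) = g v := fun v i j hij hv =>
    update_eq_of_forall_shift hij (hshift v j hv i) N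
  -- Outside the box the potential is constant: starting with coordinate `j` large, set coordinates
  -- `j + 1` and `j + 2` to `N`, then coordinate `j`. At every move some fixed coordinate is large,
  -- so the path meets no edge of `a`.
  have hout : ∀ (v : Vertex) (j : Fin 3), N ≤ (v j).natAbs → g v = g fun _ => N :=
    fun v j hv => by
    have h01 : ∀ j : Fin 3, j + 1 ≠ j := by decide
    have h02 : ∀ j : Fin 3, j + 2 ≠ j := by decide
    have h12 : ∀ j : Fin 3, j + 1 ≠ j + 2 := by decide
    rw [← hupd v (j + 1) j (h01 j) hv,
      ← hupd _ (j + 2) j (h02 j) (by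
        rwa [Function.update_of_ne (h01 j).symm]),
      ← hupd _ j (j + 2) (h02 j).symm (by simp)]
    congr 1
    ext l
    obtain rfl | rfl | rfl : l = j ∨ l = j + 1 ∨ l = j + 2 := by
      clear hv; revert l j; decide
    · simp
    · rw [Function.update_of_ne (h01 j), Function.update_of_ne (h12 j)]
      simp
    · rw [Function.update_of_ne (h02 j)]
      simp
  -- Subtracting the outer value makes the potential finitely supported; modulo 2 this constant
  -- cancels in the differential.
  let c := g fun _ => N
  let W : Finset Vertex := Fintype.piFinset fun _ => Finset.Ioo (-N : ℤ) N
  have hW : ∀ v, (if v ∈ W then g v + c else 0) = g v + c := fun v => by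
    refine ite_eq_left_iff.2 fun hv => ?_
    simp only [W, Fintype.mem_piFinset, not_forall, Finset.mem_Ioo] at hv
    obtain ⟨j, hj⟩ := hv
    rw [hout v j (by omega)]
    exact (CharTwo.add_self_eq_zero _).symm
  have hsum : a = ∑ v ∈ W, (g v + c) • coboundary v := by
    ext ⟨w, i⟩
    rw [sum_smul_coboundary_apply W (fun v => g v + c), hW, hW, hg]
    linear_combination -CharTwo.add_self_eq_zero c
  rw [hsum]
  exact Submodule.sum_mem _ fun v _ =>
    Submodule.smul_mem _ _ (Submodule.subset_span ⟨v, rfl⟩)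

/-! ### Pauli operators -/

/-- The character `x ↦ (-1)ˣ`. -/
def sgn (x : ZMod 2) : ℂ := if x = 0 then 1 else -1

theorem sgn_zero : sgn 0 = 1 := if_pos rfl

theorem sgn_one : sgn 1 = -1 := if_neg (by decide)

theorem sgn_of_ne_zero {x : ZMod 2} (hx : x ≠ 0) : sgn x = -1 := if_neg hx

theorem sgn_add (x y : ZMod 2) : sgn (x + y) = sgn x * sgn y := by
  have h : ∀ x : ZMod 2, x = 0 ∨ x = 1 := by decide
  obtain rfl | rfl := h x <;> obtain rfl | rfl := h y <;>
    simp [sgn_zero, sgn_one, CharTwo.add_self_eq_zero]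

/-- The values of a spin, as residues modulo `2`. -/
def toBit : Fin 2 ≃+ ZMod 2 := AddEquiv.refl (ZMod 2)

theorem toBit_zero : toBit 0 = 0 := rfl

theorem toBit_one : toBit 1 = 1 := rfl

/-- A configuration as a cochain modulo `2`. -/
def bits (s : Conf) : Edge → ZMod 2 := fun e => toBit (s e)

/-- Flip the spins of `s` on the edges of `a`. -/
def flip (a : Chain) (s : Conf) : Conf := fun e => s e + toBit.symm (a e)

theorem bits_flip (a : Chain) (s : Conf) : bits (flip a s) = bits s + a := by
  funext e
  simp [bits, flip]

theorem flip_flip (a a' : Chain) (s : Conf) : flip a' (flip a s) = flip (a + a') s := by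
  funext e
  simp [flip, add_assoc]

theorem flip_zero (s : Conf) : flip 0 s = s := by
  funext e
  simp [flip]

/-- The operator `∏_{e ∈ b} σᶻ_e ∏_{e ∈ a} σˣ_e`. -/
def pauli (a b : Chain) : QuasiLocal :=
  ofLocal (a.support ∪ b.support) (Matrix.of fun r t =>
    if t = restr _ (flip a (splice _ 0 r)) then sgn (pairing b (bits (splice _ 0 r))) else 0)

/-- The region contains both supports, so the reference configuration used outside it does not
matter. Pauli identities thus reduce to computations with configurations. -/
theorem pauli_apply (a b : Chain) (ψ : BigHilbert) (s : Conf) :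
    (pauli a b : BigHilbert →L[ℂ] BigHilbert) ψ s =
      sgn (pairing b (bits s)) * ψ (flip a s) := by
  change localHom _ _ ψ s = _
  rw [localHom_apply]
  simp only [Matrix.of_apply, ite_mul, zero_mul, Finset.sum_ite_eq', Finset.mem_univ, if_true]
  congr 2
  · refine pairing_congr fun e he => ?_
    simp only [bits, splice, restr]
    rw [dif_pos (Finset.mem_union_right _ he)]
  · refine congrArg (fun c : Conf => ψ c) (funext fun e => ?_)
    by_cases h : e ∈ a.support ∪ b.support
    · simp only [splice, restr, flip, dif_pos h]
    · have ha : a e = 0 := by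
        by_contra h0
        exact h (Finset.mem_union_left _ (Finsupp.mem_support_iff.2 h0))
      simp only [splice, dif_neg h, flip, ha, map_zero, add_zero]

theorem quasiLocal_ext {x y : QuasiLocal}
    (h : ∀ ψ s, (x : BigHilbert →L[ℂ] BigHilbert) ψ s = (y : BigHilbert →L[ℂ] BigHilbert) ψ s) :
    x = y :=
  Subtype.ext (ContinuousLinearMap.ext fun ψ => lp.ext (funext fun s => h ψ s))

theorem pauli_zero : pauli 0 0 = 1 := quasiLocal_ext fun ψ s => by
  rw [pauli_apply, pairing_zero_left, sgn_zero, one_mul, flip_zero]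
  rfl

/-- The sign comes from evaluating the character of `b'` at a configuration already flipped along
`a`. -/
theorem pauli_mul (a b a' b' : Chain) :
    pauli a b * pauli a' b' = sgn (pairing b' a) • pauli (a + a') (b + b') :=
  quasiLocal_ext fun ψ s => by
    change (pauli a b : BigHilbert →L[ℂ] BigHilbert)
      ((pauli a' b' : BigHilbert →L[ℂ] BigHilbert) ψ) s = sgn (pairing b' a) *
        (pauli (a + a') (b + b') : BigHilbert →L[ℂ] BigHilbert) ψ s
    rw [pauli_apply, pauli_apply, pauli_apply, flip_flip, bits_flip,
      pairing_add_right, pairing_add_left,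
      sgn_add, sgn_add]
    ring

theorem onEdge_apply (m : Matrix (Fin 2) (Fin 2) ℂ) (e : Edge) (ψ : BigHilbert) (s : Conf) :
    (onEdge m e : BigHilbert →L[ℂ] BigHilbert) ψ s =
      m (s e) 0 * ψ (Function.update s e 0) + m (s e) 1 * ψ (Function.update s e 1) := by
  have hs : ∀ t : ({e} : Finset Edge) → Fin 2,
      splice {e} s t = Function.update s e (t ⟨e, by simp⟩) := fun t => by
    funext e'
    by_cases h : e' = e
    · subst h; simp [splice]
    · simp [splice, h]
  change localHom _ _ ψ s = _
  rw [localHom_apply]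
  simp only [hs, Matrix.of_apply, restr]
  let E : (({e} : Finset Edge) → Fin 2) ≃ Fin 2 :=
    { toFun := fun t => t ⟨e, by simp⟩
      invFun := fun x _ => x
      left_inv := fun t => by
        funext e'
        obtain ⟨e', he'⟩ := e'
        obtain rfl := Finset.mem_singleton.1 he'
        rfl
      right_inv := fun x => rfl }
  exact (Fintype.sum_equiv E _ (fun x => m (s e) x * ψ (Function.update s e x)) fun t => rfl).trans
    (Fin.sum_univ_two _)

theorem flip_single (e : Edge) (s : Conf) :
    flip (Finsupp.single e 1) s = Function.update s e (s e + 1) := by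
  funext e'
  by_cases h : e' = e
  · subst h
    simp only [flip, Finsupp.single_eq_same, Function.update_self]
    rfl
  · simp only [flip, Finsupp.single_eq_of_ne h, Function.update_of_ne h, map_zero, add_zero]

theorem sigmaX_eq (e : Edge) : sigmaX e = pauli (Finsupp.single e 1) 0 :=
  quasiLocal_ext fun ψ s => by
    rw [sigmaX, onEdge_apply, pauli_apply, pairing_zero_left, sgn_zero, flip_single]
    generalize s e = x
    fin_cases x <;> simp

theorem sigmaZ_eq (e : Edge) : sigmaZ e = pauli 0 (Finsupp.single e 1) :=
  quasiLocal_ext fun ψ s => by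
    rw [sigmaZ, onEdge_apply, pauli_apply, pairing_single, flip_zero]
    have h : ψ s = ψ (Function.update s e (s e)) := by rw [Function.update_eq_self]
    rw [h, bits]
    generalize s e = x
    fin_cases x
    · simp [toBit_zero, sgn_zero]
    · simp [toBit_one, sgn_one]

theorem prod_sigmaX (L : List Edge) :
    (L.map sigmaX).prod = pauli (L.map fun e => Finsupp.single e (1 : ZMod 2)).sum 0 := by
  induction L with
  | nil => exact pauli_zero.symm
  | cons e L ih =>
    rw [List.map_cons, List.prod_cons, ih, sigmaX_eq, pauli_mul, pairing_zero_left, sgn_zero,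
      one_smul, add_zero, List.map_cons, List.sum_cons]

theorem prod_sigmaZ (L : List Edge) :
    (L.map sigmaZ).prod = pauli 0 (L.map fun e => Finsupp.single e (1 : ZMod 2)).sum := by
  induction L with
  | nil => exact pauli_zero.symm
  | cons e L ih =>
    rw [List.map_cons, List.prod_cons, ih, sigmaZ_eq, pauli_mul, Finsupp.coe_zero,
      pairing_zero_right, sgn_zero, one_smul, add_zero, List.map_cons, List.sum_cons]

theorem starOp_eq (v : Vertex) : starOp v = pauli (coboundary v) 0 := prod_sigmaX _

theorem plaqOp_eq (f : Face) : plaqOp f = pauli 0 (boundary f) := prod_sigmaZ _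

theorem star_onEdge (m : Matrix (Fin 2) (Fin 2) ℂ) (e : Edge) :
    star (onEdge m e) = onEdge (star m) e :=
  Subtype.ext (map_star (localHom {e}) _).symm

theorem pauli_add_left (a a' : Chain) : pauli (a + a') 0 = pauli a 0 * pauli a' 0 := by
  rw [pauli_mul, pairing_zero_left, sgn_zero, one_smul, add_zero]

theorem pauli_add_right (b b' : Chain) : pauli 0 (b + b') = pauli 0 b * pauli 0 b' := by
  rw [pauli_mul, Finsupp.coe_zero, pairing_zero_right, sgn_zero, one_smul, add_zero]

theorem single_eq_zero_or_one (e : Edge) (x : ZMod 2) :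
    Finsupp.single e x = 0 ∨ Finsupp.single e x = Finsupp.single e 1 := by
  obtain rfl | rfl : x = 0 ∨ x = 1 := by revert x; decide
  · exact Or.inl (Finsupp.single_zero e)
  · exact Or.inr rfl

/-- The operators `σˣ` are self-adjoint and commute, so reversing their product under the adjoint is
harmless. -/
theorem star_pauli_left (a : Chain) : star (pauli a 0) = pauli a 0 := by
  induction a using Finsupp.induction_linear with
  | zero => rw [pauli_zero, star_one]
  | add a a' h h' => rw [pauli_add_left, star_mul, h, h', ← pauli_add_left, add_comm,
      pauli_add_left]
  | single e x =>
    obtain h | h := single_eq_zero_or_one e x <;> rw [h]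
    · rw [pauli_zero, star_one]
    · rw [← sigmaX_eq, sigmaX, star_onEdge]
      congr 1
      ext i j
      fin_cases i <;> fin_cases j <;> simp [Matrix.star_apply]

theorem star_pauli_right (b : Chain) : star (pauli 0 b) = pauli 0 b := by
  induction b using Finsupp.induction_linear with
  | zero => rw [pauli_zero, star_one]
  | add b b' h h' => rw [pauli_add_right, star_mul, h, h', ← pauli_add_right, add_comm,
      pauli_add_right]
  | single e x =>
    obtain h | h := single_eq_zero_or_one e x <;> rw [h]
    · rw [pauli_zero, star_one]
    · rw [← sigmaZ_eq, sigmaZ, star_onEdge]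
      congr 1
      ext i j
      fin_cases i <;> fin_cases j <;> simp [Matrix.star_apply]

theorem star_starOp (v : Vertex) : star (starOp v) = starOp v := by
  rw [starOp_eq, star_pauli_left]

theorem star_plaqOp (f : Face) : star (plaqOp f) = plaqOp f := by
  rw [plaqOp_eq, star_pauli_right]

theorem starOp_mul_self (v : Vertex) : starOp v * starOp v = 1 := by
  rw [starOp_eq, ← pauli_add_left, ZModModule.add_self, pauli_zero]

theorem plaqOp_mul_self (f : Face) : plaqOp f * plaqOp f = 1 := by
  rw [plaqOp_eq, ← pauli_add_right, ZModModule.add_self, pauli_zero]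

/-- The span of the Pauli operators. -/
def pauliSpan : Submodule ℂ QuasiLocal := Submodule.span ℂ (Set.range fun p : Chain × Chain =>
  pauli p.1 p.2)

theorem pauli_mem (a b : Chain) : pauli a b ∈ pauliSpan := Submodule.subset_span ⟨(a, b), rfl⟩

theorem mul_mem_pauliSpan {x y : QuasiLocal} (hx : x ∈ pauliSpan) (hy : y ∈ pauliSpan) :
    x * y ∈ pauliSpan := by
  induction hx using Submodule.span_induction with
  | mem x hx =>
    obtain ⟨⟨a, b⟩, rfl⟩ := hx
    induction hy using Submodule.span_induction with
    | mem y hy =>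
      obtain ⟨⟨a', b'⟩, rfl⟩ := hy
      exact pauli_mul a b a' b' ▸ Submodule.smul_mem _ _ (pauli_mem _ _)
    | zero => rw [mul_zero]; exact zero_mem _
    | add y y' _ _ h h' => rw [mul_add]; exact add_mem h h'
    | smul c y _ h => rw [mul_smul_comm]; exact Submodule.smul_mem _ _ h
  | zero => rw [zero_mul]; exact zero_mem _
  | add x x' _ _ h h' => rw [add_mul]; exact add_mem h h'
  | smul c x _ h => rw [smul_mul_assoc]; exact Submodule.smul_mem _ _ h

/-- The projection onto the configurations that agree with `r` on `Λ`. -/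
theorem exists_projection (r : Conf) (Λ : Finset Edge) : ∃ p ∈ pauliSpan, ∀ ψ s,
    (p : BigHilbert →L[ℂ] BigHilbert) ψ s = if ∀ e ∈ Λ, s e = r e then ψ s else 0 := by
  classical
  induction Λ using Finset.induction_on with
  | empty => exact ⟨1, pauli_zero ▸ pauli_mem 0 0, fun ψ s => by simp⟩
  | insert e Λ he ih =>
    obtain ⟨p, hp, hpψ⟩ := ih
    -- The new factor `(1 ± σᶻ_e) / 2`, with the sign given by `r e`, is the spectral projection
    -- onto spin `r e` at `e`.
    refine ⟨((1 / 2 : ℂ) • (pauli 0 0 + sgn (toBit (r e)) • pauli 0 (Finsupp.single e 1))) * p,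
      mul_mem_pauliSpan (Submodule.smul_mem _ _ (add_mem (pauli_mem _ _)
        (Submodule.smul_mem _ _ (pauli_mem _ _)))) hp, fun ψ s => ?_⟩
    change (1 / 2 : ℂ) * ((pauli 0 0 : BigHilbert →L[ℂ] BigHilbert)
      ((p : BigHilbert →L[ℂ] BigHilbert) ψ) s + sgn (toBit (r e)) *
        (pauli 0 (Finsupp.single e 1) : BigHilbert →L[ℂ] BigHilbert)
          ((p : BigHilbert →L[ℂ] BigHilbert) ψ) s) = _
    rw [pauli_apply, pauli_apply, flip_zero, pairing_zero_left, pairing_single, sgn_zero, hpψ]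
    simp only [Finset.forall_mem_insert]
    have hse : (s e = r e ∧ sgn (toBit (r e)) * sgn (toBit (s e)) = 1) ∨
        (s e ≠ r e ∧ sgn (toBit (r e)) * sgn (toBit (s e)) = -1) := by
      have h : ∀ x : Fin 2, x = 0 ∨ x = 1 := by decide
      obtain hs | hs := h (s e) <;> obtain hr | hr := h (r e) <;> rw [hs, hr] <;>
        simp [toBit_zero, toBit_one, sgn_zero, sgn_one]
    rw [bits]
    rw [← mul_assoc]
    obtain ⟨h, hs⟩ | ⟨h, hs⟩ := hse <;> rw [hs]
    · simp only [h, true_and]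
      ring
    · simp only [h, false_and, if_false]
      ring

/-- Group the matrix entries by the difference `u` between column and row: the matrix unit at `(r, r
+ u)` is the projection onto `r` followed on its right by the spin flip along `u`. -/
theorem ofLocal_mem_pauliSpan (Λ : Finset Edge) (M : Matrix (Λ → Fin 2) (Λ → Fin 2) ℂ) :
    ofLocal Λ M ∈ pauliSpan := by
  classical
  choose p hp hpψ using fun r => exists_projection r Λ
  let c : (Λ → Fin 2) → Chain := fun u => ∑ e : Λ, Finsupp.single e.1 (toBit (u e))
  have hc : ∀ u s, flip (c u) s = s + splice Λ 0 u := fun u s => by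
    funext e
    have hce : c u e = toBit (splice Λ 0 u e) := by
      simp only [c, Finsupp.finsetSum_apply]
      by_cases h : e ∈ Λ
      · rw [Finset.sum_eq_single ⟨e, h⟩]
        · simp only [splice, dif_pos h, Finsupp.single_eq_same]
        · intro e' _ he'
          exact Finsupp.single_eq_of_ne fun h' => he' (Subtype.ext h'.symm)
        · simp
      · simp only [splice, dif_neg h, Pi.zero_apply, map_zero]
        exact Finset.sum_eq_zero fun e' _ => Finsupp.single_eq_of_ne fun h' => h (h' ▸ e'.2)
    simp only [flip, hce, AddEquiv.symm_apply_apply, Pi.add_apply]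
  have key : ofLocal Λ M = ∑ u : Λ → Fin 2, ∑ r : Λ → Fin 2,
      M r (r + u) • (p (splice Λ 0 r) * pauli (c u) 0) := quasiLocal_ext fun ψ s => by
    change localHom Λ M ψ s = _
    rw [localHom_apply, sum_splice_eq Λ M ψ]
    have hval : ∀ (F : (Λ → Fin 2) → (Λ → Fin 2) → QuasiLocal),
        ((∑ u, ∑ r, F u r : QuasiLocal) : BigHilbert →L[ℂ] BigHilbert) ψ s =
          ∑ u, ∑ r, (F u r : BigHilbert →L[ℂ] BigHilbert) ψ s := fun F => by
      let L : QuasiLocal →+ ℂ :=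
        { toFun := fun x => (x : BigHilbert →L[ℂ] BigHilbert) ψ s
          map_zero' := rfl
          map_add' := fun _ _ => rfl }
      exact (map_sum L _ _).trans (Finset.sum_congr rfl fun _ _ => map_sum L _ _)
    rw [hval]
    refine Finset.sum_congr rfl fun u _ => ?_
    rw [Finset.sum_eq_single (restr Λ s)]
    · change _ = M _ _ * (p _ : BigHilbert →L[ℂ] BigHilbert)
        ((pauli (c u) 0 : BigHilbert →L[ℂ] BigHilbert) ψ) s
      rw [hpψ, if_pos, pauli_apply, pairing_zero_left, sgn_zero, one_mul, hc]
      intro e he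
      simp [splice, restr, he]
    · intro r _ hr
      change M _ _ * (p _ : BigHilbert →L[ℂ] BigHilbert)
        ((pauli (c u) 0 : BigHilbert →L[ℂ] BigHilbert) ψ) s = 0
      rw [hpψ, if_neg, mul_zero]
      intro h
      refine hr (funext fun e => ?_)
      have := h e e.2
      simpa [splice, restr] using this.symm
    · simp
  rw [key]
  exact Submodule.sum_mem _ fun u _ => Submodule.sum_mem _ fun r _ =>
    Submodule.smul_mem _ _ (mul_mem_pauliSpan (hp _) (pauli_mem _ _))

/-! ### Uniqueness of the stabilized state -/

/-- The states with `ω(A_v) = ω(B_f) = 1` for all `v` and `f`. -/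
def stabilizedStates : Set (QuasiLocal →ₗ[ℂ] ℂ) :=
  {ω | ω ∈ states ∧ (∀ v, ω (starOp v) = 1) ∧ ∀ f, ω (plaqOp f) = 1}

section Stabilized

variable {ω : QuasiLocal →ₗ[ℂ] ℂ} (hω : ω ∈ stabilizedStates)

include hω

theorem apply_mul_starOp (v : Vertex) (x : QuasiLocal) : ω (x * starOp v) = ω x :=
  apply_mul_stabilizer hω.1.1 hω.1.2 (star_starOp v) (starOp_mul_self v) (hω.2.1 v) x

theorem apply_starOp_mul (v : Vertex) (x : QuasiLocal) : ω (starOp v * x) = ω x :=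
  apply_stabilizer_mul hω.1.1 hω.1.2 (star_starOp v) (starOp_mul_self v) (hω.2.1 v) x

theorem apply_mul_plaqOp (f : Face) (x : QuasiLocal) : ω (x * plaqOp f) = ω x :=
  apply_mul_stabilizer hω.1.1 hω.1.2 (star_plaqOp f) (plaqOp_mul_self f) (hω.2.2 f) x

theorem apply_plaqOp_mul (f : Face) (x : QuasiLocal) : ω (plaqOp f * x) = ω x :=
  apply_stabilizer_mul hω.1.1 hω.1.2 (star_plaqOp f) (plaqOp_mul_self f) (hω.2.2 f) x

/-- `A_v` is absorbed on the right, and `B_f` in the next lemma on the left, because `pauli_mul`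
produces no sign on those sides. -/
theorem apply_pauli_add_coboundary (a b : Chain) (v : Vertex) :
    ω (pauli (a + coboundary v) b) = ω (pauli a b) := by
  rw [← apply_mul_starOp hω v (pauli a b), starOp_eq, pauli_mul, pairing_zero_left, sgn_zero,
    one_smul, add_zero]

theorem apply_pauli_add_boundary (a b : Chain) (f : Face) :
    ω (pauli a (b + boundary f)) = ω (pauli a b) := by
  rw [← apply_plaqOp_mul hω f (pauli a b), plaqOp_eq, pauli_mul, Finsupp.coe_zero,
    pairing_zero_right, sgn_zero, one_smul, zero_add, add_comm]

/-- Here `A_v` anticommutes with the Pauli operator. Absorbing it on the left rather than the right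
gives a minus sign, so the expectation equals its negative. -/
theorem apply_pauli_eq_zero_of_coboundary {b : Chain} {v : Vertex}
    (hb : pairing b (coboundary v) ≠ 0) (a : Chain) : ω (pauli a b) = 0 := by
  have h := apply_starOp_mul hω v (pauli a b)
  rw [starOp_eq, pauli_mul, sgn_of_ne_zero hb, zero_add, add_comm, map_smul,
    apply_pauli_add_coboundary hω, neg_smul, one_smul] at h
  exact self_eq_neg.1 h.symm

theorem apply_pauli_eq_zero_of_boundary {a : Chain} {f : Face}
    (ha : pairing (boundary f) a ≠ 0) (b : Chain) : ω (pauli a b) = 0 := by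
  have h := apply_mul_plaqOp hω f (pauli a b)
  rw [plaqOp_eq, pauli_mul, sgn_of_ne_zero ha, add_zero, map_smul,
    apply_pauli_add_boundary hω, neg_smul, one_smul] at h
  exact self_eq_neg.1 h.symm

theorem apply_pauli_add_left {c : Chain}
    (hc : c ∈ Submodule.span (ZMod 2) (Set.range coboundary)) (a b : Chain) :
    ω (pauli (a + c) b) = ω (pauli a b) := by
  induction hc using Submodule.span_induction generalizing a with
  | mem c hc =>
    obtain ⟨v, rfl⟩ := hc
    exact apply_pauli_add_coboundary hω a b v
  | zero => rw [add_zero]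
  | add c c' _ _ h h' => rw [← add_assoc, h', h]
  | smul x c _ h =>
    obtain rfl | rfl : x = 0 ∨ x = 1 := by revert x; decide
    · rw [zero_smul, add_zero]
    · rw [one_smul, h]

theorem apply_pauli_add_right {c : Chain}
    (hc : c ∈ Submodule.span (ZMod 2) (Set.range boundary)) (a b : Chain) :
    ω (pauli a (b + c)) = ω (pauli a b) := by
  induction hc using Submodule.span_induction generalizing b with
  | mem c hc =>
    obtain ⟨f, rfl⟩ := hc
    exact apply_pauli_add_boundary hω a b f
  | zero => rw [add_zero]
  | add c c' _ _ h h' => rw [← add_assoc, h', h]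
  | smul x c _ h =>
    obtain rfl | rfl : x = 0 ∨ x = 1 := by revert x; decide
    · rw [zero_smul, add_zero]
    · rw [one_smul, h]

open Classical in
-- The right-hand side does not involve `ω`: the expectations of all Paulis are forced. The value 1
-- is where the topology of `ℤ³` enters.
theorem apply_pauli (a b : Chain) : ω (pauli a b) =
    if (∀ f, pairing (boundary f) a = 0) ∧ ∀ v, pairing b (coboundary v) = 0 then 1 else 0 := by
  split_ifs with h
  · rw [← zero_add a, ← zero_add b, apply_pauli_add_left hω (mem_span_coboundary h.1),
      apply_pauli_add_right hω (mem_span_boundary h.2), pauli_zero, hω.1.2]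
  · rw [not_and_or, not_forall, not_forall] at h
    obtain ⟨f, hf⟩ | ⟨v, hv⟩ := h
    · exact apply_pauli_eq_zero_of_boundary hω hf b
    · exact apply_pauli_eq_zero_of_coboundary hω hv a

end Stabilized

theorem dense_range_ofLocal :
    Dense {x : QuasiLocal | ∃ Λ M, ofLocal Λ M = x} := fun x => by
  rw [Topology.IsEmbedding.subtypeVal.closure_eq_preimage_closure_image, Set.mem_preimage]
  refine closure_mono (fun T hT => ?_) x.2
  obtain ⟨Λ, M, rfl⟩ := mem_localAlgebra.1 hT
  exact ⟨_, ⟨Λ, M, rfl⟩, rfl⟩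

theorem continuous_of_mem_states {ω : QuasiLocal →ₗ[ℂ] ℂ} (hω : ω ∈ states) : Continuous ω :=
  continuous_of_forall_nonneg hω.1

theorem stabilizedStates_subsingleton : stabilizedStates.Subsingleton := by
  intro ω hω φ hφ
  have hspan : ∀ x ∈ pauliSpan, ω x = φ x := LinearMap.eqOn_span (by
    rintro _ ⟨⟨a, b⟩, rfl⟩
    exact (apply_pauli hω a b).trans (apply_pauli hφ a b).symm)
  refine LinearMap.ext fun x => congrFun (Continuous.ext_on dense_range_ofLocal
    (continuous_of_mem_states hω.1) (continuous_of_mem_states hφ.1) ?_) x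
  rintro _ ⟨Λ, M, rfl⟩
  exact hspan _ (ofLocal_mem_pauliSpan Λ M)

/-! ### Existence of the stabilized state -/

/-- The functional `a ↦ ⟨ψ, a ψ⟩`. -/
def vectorFunctional (ψ : BigHilbert) : QuasiLocal →ₗ[ℂ] ℂ where
  toFun a := inner ℂ ψ ((a : BigHilbert →L[ℂ] BigHilbert) ψ)
  map_add' _ _ := inner_add_right ψ _ _
  map_smul' c _ := inner_smul_right ψ _ c

theorem vectorFunctional_apply (ψ : BigHilbert) (a : QuasiLocal) :
    vectorFunctional ψ a = inner ℂ ψ ((a : BigHilbert →L[ℂ] BigHilbert) ψ) := rfl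

theorem vectorFunctional_mem_states {ψ : BigHilbert} (hψ : ‖ψ‖ = 1) :
    vectorFunctional ψ ∈ states := by
  refine ⟨fun a => ?_, ?_⟩
  · change 0 ≤ inner ℂ ψ (star (a : BigHilbert →L[ℂ] BigHilbert)
      ((a : BigHilbert →L[ℂ] BigHilbert) ψ))
    rw [ContinuousLinearMap.star_eq_adjoint, ContinuousLinearMap.adjoint_inner_right,
      inner_self_eq_norm_sq_to_K]
    exact pow_nonneg (RCLike.ofReal_nonneg.2
      (norm_nonneg ((a : BigHilbert →L[ℂ] BigHilbert) ψ))) 2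
  · change inner ℂ ψ ψ = 1
    rw [inner_self_eq_norm_sq_to_K, hψ]
    simp

theorem norm_vectorFunctional_le {ψ : BigHilbert} (hψ : ‖ψ‖ = 1) (a : QuasiLocal) :
    ‖vectorFunctional ψ a‖ ≤ ‖a‖ := by
  rw [vectorFunctional_apply]
  refine (norm_inner_le_norm (𝕜 := ℂ) ψ _).trans ?_
  rw [hψ, one_mul]
  exact (ContinuousLinearMap.le_opNorm _ _).trans (by rw [hψ, mul_one]; rfl)

theorem starOp_comm (v w : Vertex) : starOp v * starOp w = starOp w * starOp v := by
  rw [starOp_eq, starOp_eq, ← pauli_add_left, add_comm, pauli_add_left]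

theorem plaqOp_starOp_comm (f : Face) (v : Vertex) : plaqOp f * starOp v = starOp v * plaqOp f := by
  rw [starOp_eq, plaqOp_eq, pauli_mul, pauli_mul, pairing_boundary_coboundary, pairing_zero_left,
    add_comm (coboundary v), add_comm (boundary f)]

/-- The all-zero basis vector is fixed by every `B_f`; applying `1 + A_w` for each `w ∈ V` adds the
star constraints. Since `A_w` permutes basis vectors, amplitudes stay nonnegative and the one at `0`
stays positive, so the vector never vanishes. -/
theorem exists_stabilized_nonneg (V : Finset Vertex) : ∃ ψ : BigHilbert, (∀ s, 0 ≤ ψ s) ∧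
    0 < ψ 0 ∧ (∀ v ∈ V, (starOp v : BigHilbert →L[ℂ] BigHilbert) ψ = ψ) ∧
      ∀ f, (plaqOp f : BigHilbert →L[ℂ] BigHilbert) ψ = ψ := by
  classical
  induction V using Finset.induction_on with
  | empty =>
    refine ⟨lp.single 2 0 1, fun s => ?_, ?_, by simp, fun f => ?_⟩
    · rw [lp.coeFn_single, Pi.single_apply]
      split_ifs <;> simp
    · rw [lp.coeFn_single, Pi.single_eq_same]
      exact one_pos
    · ext s
      rw [plaqOp_eq, pauli_apply, flip_zero, lp.coeFn_single]
      by_cases hs : s = 0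
      · have hb : bits s = 0 := by
          funext e
          simp [bits, hs]
        rw [hb, pairing_zero_right, sgn_zero, one_mul]
      · rw [Pi.single_eq_of_ne hs, mul_zero]
  | insert w V _ ih =>
    obtain ⟨ψ, hψ, hψ0, hA, hB⟩ := ih
    have hcomm : ∀ x : QuasiLocal, x * starOp w = starOp w * x →
        (x : BigHilbert →L[ℂ] BigHilbert) ψ = ψ → (x : BigHilbert →L[ℂ] BigHilbert)
          (ψ + (starOp w : BigHilbert →L[ℂ] BigHilbert) ψ) =
            ψ + (starOp w : BigHilbert →L[ℂ] BigHilbert) ψ := fun x hx hxψ => by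
      have h := congrArg (fun y : QuasiLocal => (y : BigHilbert →L[ℂ] BigHilbert) ψ) hx
      change (x : BigHilbert →L[ℂ] BigHilbert) ((starOp w : BigHilbert →L[ℂ] BigHilbert) ψ) =
        (starOp w : BigHilbert →L[ℂ] BigHilbert) ((x : BigHilbert →L[ℂ] BigHilbert) ψ) at h
      rw [map_add, h, hxψ]
    have hw : ∀ s, 0 ≤ (starOp w : BigHilbert →L[ℂ] BigHilbert) ψ s := fun s => by
      rw [starOp_eq, pauli_apply, pairing_zero_left, sgn_zero, one_mul]
      exact hψ _
    refine ⟨ψ + (starOp w : BigHilbert →L[ℂ] BigHilbert) ψ, fun s => add_nonneg (hψ s) (hw s),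
      add_pos_of_pos_of_nonneg hψ0 (hw 0), fun v hv => ?_,
      fun f => hcomm _ (plaqOp_starOp_comm f w) (hB f)⟩
    obtain rfl | hv := Finset.mem_insert.1 hv
    · have h := congrArg (fun y : QuasiLocal => (y : BigHilbert →L[ℂ] BigHilbert) ψ)
        (starOp_mul_self v)
      change (starOp v : BigHilbert →L[ℂ] BigHilbert)
        ((starOp v : BigHilbert →L[ℂ] BigHilbert) ψ) = ψ at h
      rw [map_add, h, add_comm]
    · exact hcomm _ (starOp_comm v w) (hA v hv)

theorem exists_stabilized_unit (V : Finset Vertex) : ∃ ψ : BigHilbert, ‖ψ‖ = 1 ∧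
    (∀ v ∈ V, (starOp v : BigHilbert →L[ℂ] BigHilbert) ψ = ψ) ∧
      ∀ f, (plaqOp f : BigHilbert →L[ℂ] BigHilbert) ψ = ψ := by
  obtain ⟨ψ, -, hψ0, hA, hB⟩ := exists_stabilized_nonneg V
  have hψ : ψ ≠ 0 := by
    rintro rfl
    exact lt_irrefl _ hψ0
  refine ⟨((‖ψ‖⁻¹ : ℝ) : ℂ) • ψ, ?_, fun v hv => by rw [map_smul, hA v hv],
    fun f => by rw [map_smul, hB f]⟩
  rw [norm_smul, Complex.norm_real, norm_inv, norm_norm, inv_mul_cancel₀ (norm_ne_zero_iff.2 hψ)]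

theorem vectorFunctional_eq_one {ψ : BigHilbert} (hψ : ‖ψ‖ = 1) {x : QuasiLocal}
    (hx : (x : BigHilbert →L[ℂ] BigHilbert) ψ = ψ) : vectorFunctional ψ x = 1 := by
  rw [vectorFunctional_apply, hx, inner_self_eq_norm_sq_to_K, hψ]
  simp

theorem stabilizedStates_nonempty : stabilizedStates.Nonempty := by
  choose ψ hψ hA hB using exists_stabilized_unit
  -- An ultrafilter finer than `atTop` makes all the expectations converge simultaneously, since
  -- those of `a` stay in the compact disc of radius `‖a‖`. The limits are linear and positive, and
  -- each constraint holds from some finite `V` on.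
  let F : Ultrafilter (Finset Vertex) := Ultrafilter.of Filter.atTop
  have hlim : ∀ a, ∃ z, Filter.Tendsto (fun V => vectorFunctional (ψ V) a) F (𝓝 z) := fun a => by
    obtain ⟨z, -, hz⟩ := (isCompact_closedBall (0 : ℂ) ‖a‖).ultrafilter_le_nhds'
      (F.map fun V => vectorFunctional (ψ V) a)
      (Filter.mem_map.2 (Filter.univ_mem' fun V =>
        mem_closedBall_zero_iff.2 (norm_vectorFunctional_le (hψ V) a)))
    exact ⟨z, hz⟩
  choose ω hω using hlim
  have hconst : ∀ a z, (∀ᶠ V in Filter.atTop, vectorFunctional (ψ V) a = z) → ω a = z :=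
    fun a z h => tendsto_nhds_unique (hω a)
      (tendsto_const_nhds.congr' ((h.filter_mono (Ultrafilter.of_le _)).mono fun _ h => h.symm))
  refine ⟨{ toFun := ω, map_add' := fun a b => ?_, map_smul' := fun c a => ?_ },
    ⟨fun a => ?_, ?_⟩, fun v => ?_, fun f => ?_⟩
  · refine tendsto_nhds_unique (hω (a + b)) ?_
    simpa only [map_add] using (hω a).add (hω b)
  · refine tendsto_nhds_unique (hω (c • a)) ?_
    simpa only [map_smul, RingHom.id_apply] using (hω a).const_smul c
  · exact ge_of_tendsto' (hω _) fun V => (vectorFunctional_mem_states (hψ V)).1 a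
  · exact hconst _ _ (Filter.Eventually.of_forall fun V => (vectorFunctional_mem_states (hψ V)).2)
  · exact hconst _ _ ((Filter.eventually_ge_atTop {v}).mono fun V hV =>
      vectorFunctional_eq_one (hψ V) (hA V v (hV (Finset.mem_singleton_self v))))
  · exact hconst _ _ (Filter.Eventually.of_forall fun V => vectorFunctional_eq_one (hψ V) (hB V f))

/-! ### Properties of the stabilized state -/

section Properties

variable {ω : QuasiLocal →ₗ[ℂ] ℂ}

theorem apply_le_one {φ : QuasiLocal →ₗ[ℂ] ℂ} (hφ : φ ∈ states) {u : QuasiLocal}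
    (hu : star u = u) (hu2 : u * u = 1) : φ u ≤ 1 := by
  have h := one_sub_apply_nonneg hφ.1 hu hu2
  rwa [map_sub, hφ.2, sub_nonneg] at h

theorem eq_one_of_convex_combination {s t : ℝ} (hs : 0 < s) (ht : 0 < t) (hst : s + t = 1)
    {z w : ℂ} (hz : z ≤ 1) (hw : w ≤ 1) (h : s • z + t • w = 1) : z = 1 := by
  obtain ⟨hz, hz'⟩ := Complex.le_def.1 hz
  obtain ⟨hw, hw'⟩ := Complex.le_def.1 hw
  have hre := congrArg Complex.re h
  simp only [Complex.add_re, Complex.real_smul, Complex.re_ofReal_mul, Complex.one_re] at hre hz hw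
  -- In the order on `ℂ`, `z ≤ 1` already includes equality of imaginary parts; only real parts
  -- remain.
  refine Complex.ext ?_ hz'
  rw [Complex.one_re]
  nlinarith

/-- The value 1 is the largest a state can take on a stabilizer, so both components of a convex
decomposition attain it and equal `ω` by uniqueness. -/
theorem isPureState_of_stabilized (hω : ω ∈ stabilizedStates) : IsPureState ω := by
  refine ⟨hω.1, fun φ hφ χ hχ h => ?_⟩
  obtain ⟨s, t, hs, ht, hst, rfl⟩ := h
  refine stabilizedStates_subsingleton ⟨hφ, fun v => ?_, fun f => ?_⟩ hω
  · exact eq_one_of_convex_combination hs ht hst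
      (apply_le_one hφ (star_starOp v) (starOp_mul_self v))
      (apply_le_one hχ (star_starOp v) (starOp_mul_self v)) (hω.2.1 v)
  · exact eq_one_of_convex_combination hs ht hst
      (apply_le_one hφ (star_plaqOp f) (plaqOp_mul_self f))
      (apply_le_one hχ (star_plaqOp f) (plaqOp_mul_self f)) (hω.2.2 f)

theorem isFrustrationFree_of_stabilized (hω : ω ∈ stabilizedStates) : IsFrustrationFree ω := by
  refine ⟨hω.1, fun v φ hφ => ?_, fun f φ hφ => ?_⟩
  · rw [map_sub ω, hω.1.2, hω.2.1, sub_self]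
    exact one_sub_apply_nonneg hφ.1 (star_starOp v) (starOp_mul_self v)
  · rw [map_sub ω, hω.1.2, hω.2.2, sub_self]
    exact one_sub_apply_nonneg hφ.1 (star_plaqOp f) (plaqOp_mul_self f)

theorem apply_eq_one_of_le {φ : QuasiLocal →ₗ[ℂ] ℂ} (hω : ω ∈ states) (hφ : φ ∈ states)
    {u : QuasiLocal} (hu : star u = u) (hu2 : u * u = 1) (hωu : ω u = 1)
    (h : φ (1 - u) ≤ ω (1 - u)) : φ u = 1 := by
  rw [map_sub ω, hω.2, hωu, sub_self] at h
  have h0 := le_antisymm h (one_sub_apply_nonneg hφ.1 hu hu2)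
  rw [map_sub, hφ.2, sub_eq_zero] at h0
  exact h0.symm

/-- Comparison with `ω` itself, where every term has expectation zero, forces a frustration-free
state to be stabilized. -/
theorem eq_of_isFrustrationFree (hω : ω ∈ stabilizedStates) {φ : QuasiLocal →ₗ[ℂ] ℂ}
    (hφ : IsFrustrationFree φ) : φ = ω :=
  stabilizedStates_subsingleton ⟨hφ.1,
    fun v => apply_eq_one_of_le hω.1 hφ.1 (star_starOp v) (starOp_mul_self v) (hω.2.1 v)
      (hφ.2.1 v ω hω.1),
    fun f => apply_eq_one_of_le hω.1 hφ.1 (star_plaqOp f) (plaqOp_mul_self f) (hω.2.2 f)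
      (hφ.2.2 f ω hω.1)⟩ hω

theorem apply_mul_hamiltonian (hω : ω ∈ stabilizedStates) (Λ : Finset Edge) (a : QuasiLocal) :
    ω (a * hamiltonian Λ) = 0 := by
  rw [hamiltonian, mul_add, Finset.mul_sum, Finset.mul_sum, map_add, map_sum, map_sum]
  rw [Finset.sum_eq_zero fun v _ => apply_mul_one_sub hω.1.1 hω.1.2 (star_starOp v)
      (starOp_mul_self v) (hω.2.1 v) a,
    Finset.sum_eq_zero fun f _ => apply_mul_one_sub hω.1.1 hω.1.2 (star_plaqOp f)
      (plaqOp_mul_self f) (hω.2.2 f) a, add_zero]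

theorem conj_hamiltonian_nonneg (hω : ω ∈ states) (Λ : Finset Edge) (a : QuasiLocal) :
    0 ≤ ω (star a * (hamiltonian Λ * a)) := by
  rw [hamiltonian, add_mul, Finset.sum_mul, Finset.sum_mul, mul_add, Finset.mul_sum,
    Finset.mul_sum, map_add, map_sum, map_sum]
  exact add_nonneg
    (Finset.sum_nonneg fun v _ => conj_one_sub_apply_nonneg hω.1 (star_starOp v)
      (starOp_mul_self v) a)
    (Finset.sum_nonneg fun f _ => conj_one_sub_apply_nonneg hω.1 (star_plaqOp f)
      (plaqOp_mul_self f) a)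

/-- For each finite region the energy form equals `ω (star a * (hamiltonian Λ * a))`, which is
nonnegative. This persists in the limit over regions and in the closure of the graph. -/
theorem isGroundState_of_stabilized (hω : ω ∈ stabilizedStates) : IsGroundState ω := by
  refine ⟨hω.1, fun O D h => ?_⟩
  refine energy_nonneg_of_mem_closure hω.1.1 (S := localDerivationGraph) (p := (O, D)) ?_ h
  exact fun p hp => energy_nonneg_of_tendsto hω.1.1 (apply_mul_hamiltonian hω)
    (conj_hamiltonian_nonneg hω.1) hp.2

/-! ### Translation invariance -/

/-- Translation of observables as a homomorphism. -/
def translateHom (x : Vertex) : QuasiLocal →⋆ₐ[ℂ] QuasiLocal where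
  toFun := translate x
  map_one' := Subtype.ext (map_one (shiftUnitary x).conjStarAlgEquiv)
  map_mul' _ _ := Subtype.ext (map_mul (shiftUnitary x).conjStarAlgEquiv _ _)
  map_zero' := Subtype.ext (map_zero (shiftUnitary x).conjStarAlgEquiv)
  map_add' _ _ := Subtype.ext (map_add (shiftUnitary x).conjStarAlgEquiv _ _)
  commutes' c := Subtype.ext (AlgHomClass.commutes (shiftUnitary x).conjStarAlgEquiv c)
  map_star' _ := Subtype.ext (map_star (shiftUnitary x).conjStarAlgEquiv _)

theorem translateHom_apply (x : Vertex) (a : QuasiLocal) : translateHom x a = translate x a := rfl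

theorem translate_onEdge (x : Vertex) (m : Matrix (Fin 2) (Fin 2) ℂ) (e : Edge) :
    translate x (onEdge m e) = onEdge m (shiftEdge x e) := quasiLocal_ext fun ψ s => by
  change (onEdge m e : BigHilbert →L[ℂ] BigHilbert) ((shiftUnitary x).symm ψ)
    ((shiftConf x).symm s) = _
  have hu : ∀ k, shiftConf x (Function.update ((shiftConf x).symm s) e k) =
      Function.update s (shiftEdge x e) k := fun k => by
    funext e'
    by_cases h : e' = shiftEdge x e
    · subst h
      simp [shiftConf]
    · have h' : (shiftEdge x).symm e' ≠ e := fun h' => h (by rw [← h', Equiv.apply_symm_apply])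
      simp [shiftConf, h, h']
  have hψ : ∀ c, (shiftUnitary x).symm ψ c = ψ (shiftConf x c) := fun c => rfl
  rw [onEdge_apply, onEdge_apply, hψ, hψ, hu, hu]
  rfl

theorem vertexEdges_add (v x : Vertex) :
    vertexEdges (v + x) = (vertexEdges v).map (shiftEdge x) := by
  simp [vertexEdges, shiftEdge, sub_add_eq_add_sub]

theorem faceEdges_add (f : Face) (x : Vertex) :
    faceEdges (f.1 + x, f.2) = (faceEdges f).map (shiftEdge x) := by
  simp [faceEdges, shiftEdge, add_right_comm]

theorem translate_starOp (x v : Vertex) : translate x (starOp v) = starOp (v + x) := by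
  rw [starOp, starOp, vertexEdges_add, ← translateHom_apply, map_list_prod, List.map_map,
    List.map_map]
  congr 2
  exact funext fun e => translate_onEdge x _ e

theorem translate_plaqOp (x : Vertex) (f : Face) :
    translate x (plaqOp f) = plaqOp (f.1 + x, f.2) := by
  rw [plaqOp, plaqOp, faceEdges_add, ← translateHom_apply, map_list_prod, List.map_map,
    List.map_map]
  congr 2
  exact funext fun e => translate_onEdge x _ e

/-- Translations permute the stars and plaquettes, so the translated state is again stabilized, and
uniqueness applies. -/
theorem isTranslationInvariant_of_stabilized (hω : ω ∈ stabilizedStates) :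
    IsTranslationInvariant ω := by
  intro x a
  have h : ω ∘ₗ (translateHom x).toAlgHom.toLinearMap ∈ stabilizedStates := by
    refine ⟨⟨fun a => ?_, ?_⟩, fun v => ?_, fun f => ?_⟩
    · change 0 ≤ ω (translateHom x (star a * a))
      rw [map_mul, map_star]
      exact hω.1.1 _
    · change ω (translateHom x 1) = 1
      rw [map_one, hω.1.2]
    · change ω (translate x (starOp v)) = 1
      rw [translate_starOp, hω.2.1]
    · change ω (translate x (plaqOp f)) = 1
      rw [translate_plaqOp, hω.2.2]
  exact LinearMap.congr_fun (stabilizedStates_subsingleton h hω) a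

end Properties

end ToricCode3D

end

/-! ### The main theorem -/

theorem mainTheorem9 :
    (∃! ω : ToricCode3D.QuasiLocal →ₗ[ℂ] ℂ, ω ∈ ToricCode3D.states ∧
      (∀ v, ω (ToricCode3D.starOp v) = 1) ∧ ∀ f, ω (ToricCode3D.plaqOp f) = 1) ∧
    ∀ ω ∈ ToricCode3D.states,
      (∀ v, ω (ToricCode3D.starOp v) = 1) → (∀ f, ω (ToricCode3D.plaqOp f) = 1) →
        (ToricCode3D.IsPureState ω ∧ ToricCode3D.IsFrustrationFree ω ∧
          ToricCode3D.IsTranslationInvariant ω ∧ ToricCode3D.IsGroundState ω) ∧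
        ∀ ω', ToricCode3D.IsGroundState ω' → ToricCode3D.IsFrustrationFree ω' → ω' = ω := by
  refine ⟨?_, fun ω hω hA hB => ?_⟩
  · obtain ⟨ω, hω⟩ := ToricCode3D.stabilizedStates_nonempty
    exact ⟨ω, hω, fun φ hφ => ToricCode3D.stabilizedStates_subsingleton hφ hω⟩
  · have h : ω ∈ ToricCode3D.stabilizedStates := ⟨hω, hA, hB⟩
    exact ⟨⟨ToricCode3D.isPureState_of_stabilized h, ToricCode3D.isFrustrationFree_of_stabilized h,
      ToricCode3D.isTranslationInvariant_of_stabilized h,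
      ToricCode3D.isGroundState_of_stabilized h⟩,
      fun φ _ hφ => ToricCode3D.eq_of_isFrustrationFree h hφ⟩
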